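/- Let $1<p,q<\infty$, let $n\ge 1$ be an integer, let $t_0>0$ and $\mathcal I=[0,t_0]$. For $r>1$ and $x\in\mathbb R$ write $[x]^{r-1}=|x|^{r-1}\operatorname{sgn}(x)$. An eigenpair on $[0,t_0]$ is a pair $(u,\lambda)$ with $\lambda>0$ and $u\in C^2([0,t_0])$, $u\neq 0$, such that $[u'']^{p-1}\in C^2([0,t_0])$ and \[ ([u'']^{p-1})''=\lambda\,[u]^{q-1}\quad\text{on }[0,t_0],\qquad u(0)=u(t_0)=u''(0)=u''(t_0)=0 . \] A spectral couple on $[0,t_0]$ is an eigenpair $(f,\lambda)$ with $\|f''\|_{L^p(0,t_0)}=1$ and $f'(0)>0$; then $\lambda$ is called a spectral number and $f$ a spectral function on $[0,t_0]$. The $n$-th spectral number is the $n$-th smallest one, and a spectral couple with this number is called the $n$-th spectral couple. (i) There is a unique spectral couple $(f,\lambda)$ on $[0,t_0]$ such that $f$ has exactly $n-1$ distinct zeros in $(0,t_0)$. (ii) There is a unique spectral couple $(f_1,\lambda_1)$ on $[0,1]$ for which $\lambda_1$ is the first spectral number on $[0,1]$. Let $f_{1*}:\mathbb R\to\mathbb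 R$ be the unique $2$-periodic odd function with $f_{1*}(t)=f_1(t)$ for all $t\in[0,1]$. Then \[ \Bigl(f_n(t)=\frac{f_{1*}(nt)}{n^2},\quad \lambda_n=n^{2q}\lambda_1\Bigr) \] is the unique spectral couple on $[0,1]$ associated to the $n$-th spectral number, and it is also the unique one on $[0,1]$ with exactly $n-1$ zeros in $(0,1)$. (iii) Let $(f_n,\lambda_n)$ be the $n$-th spectral couple on $[0,1]$. Then \[ \Bigl(\operatorname{SN}_n(t)=t_0^{2-1/p}f_n(t/t_0),\quad \operatorname{sn}_n=t_0^{q/p-1-2q}\lambda_n\Bigr) \] is the unique spectral couple on $[0,t_0]$ with exactly $n-1$ zeros in $(0,t_0)$. In particular, \[ \operatorname{SN}_n(t)=\frac{t_0^{2-1/p}}{n^2}f_{1*}(nt/t_0)\quad\text{and}\quad \operatorname{sn}_n=n^{2q}t_0^{q/p-1-2q}\lambda_1 \] are the $n$-th spectral function and the $n$-th spectral number on $[0,t_0]$, respectively. -/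

import Mathlib

open Set MeasureTheory

noncomputable section

/-- The signed power `[x]^{r-1} = |x|^{r-1} sgn x`. -/
def signedPow (r x : ℝ) : ℝ := Real.sign x * |x| ^ (r - 1)

/-- The second derivative of `f` on `[0, t₀]`, one-sided at the end points. -/
def secondDeriv (t₀ : ℝ) (f : ℝ → ℝ) : ℝ → ℝ := iteratedDerivWithin 2 f (Icc 0 t₀)

/-- `(f, μ)` is an eigenpair of the `pq`-biharmonic problem with Navier boundary conditions
`([f'']^{p-1})'' = μ [f]^{q-1}` on `[0, t₀]`, `f(0) = f(t₀) = f''(0) = f''(t₀) = 0`,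
with `f ≠ 0` and `μ > 0`. Only the values of `f` on `[0, t₀]` matter. -/
structure IsEigenpair (p q t₀ : ℝ) (f : ℝ → ℝ) (μ : ℝ) : Prop where
  contDiffOn : ContDiffOn ℝ 2 f (Icc 0 t₀)
  contDiffOn_signedPow :
    ContDiffOn ℝ 2 (fun t => signedPow p (secondDeriv t₀ f t)) (Icc 0 t₀)
  equation : ∀ t ∈ Icc 0 t₀,
    secondDeriv t₀ (fun s => signedPow p (secondDeriv t₀ f s)) t = μ * signedPow q (f t)
  left : f 0 = 0
  right : f t₀ = 0
  secondDeriv_left : secondDeriv t₀ f 0 = 0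
  secondDeriv_right : secondDeriv t₀ f t₀ = 0
  ne_zero : ∃ t ∈ Icc 0 t₀, f t ≠ 0
  pos : 0 < μ

/-- A spectral couple on `[0, t₀]`: an eigenpair with `‖f''‖_{L^p(0,t₀)} = 1` and `f'(0) > 0`. -/
structure IsSpectralCouple (p q t₀ : ℝ) (f : ℝ → ℝ) (μ : ℝ) : Prop where
  isEigenpair : IsEigenpair p q t₀ f μ
  norm_eq_one :
    eLpNorm (secondDeriv t₀ f) (ENNReal.ofReal p) (volume.restrict (Icc 0 t₀)) = 1
  deriv_pos : 0 < derivWithin f (Icc 0 t₀) 0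

/-- The set of spectral numbers on `[0, t₀]`. -/
def spectralNumbers (p q t₀ : ℝ) : Set ℝ := {μ | ∃ f, IsSpectralCouple p q t₀ f μ}

/-- `μ` is the `n`-th spectral number on `[0, t₀]` in increasing order (`n = 1, 2, …`). -/
def IsNthSpectralNumber (p q t₀ : ℝ) (n : ℕ) (μ : ℝ) : Prop :=
  μ ∈ spectralNumbers p q t₀ ∧ {ν ∈ spectralNumbers p q t₀ | ν < μ}.encard + 1 = n

/-- `f` has exactly `n - 1` distinct zeros in `(0, t₀)` (`n = 1, 2, …`). -/
def HasPredZeros (t₀ : ℝ) (n : ℕ) (f : ℝ → ℝ) : Prop :=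
  {t ∈ Ioo 0 t₀ | f t = 0}.encard + 1 = n

/-- `(f, μ)` is the one and only spectral couple on `[0, t₀]` with the property `P`; functions on
`[0, t₀]` are identified when they agree there. -/
def IsTheSpectralCouple (p q t₀ : ℝ) (P : (ℝ → ℝ) → ℝ → Prop) (f : ℝ → ℝ) (μ : ℝ) : Prop :=
  (IsSpectralCouple p q t₀ f μ ∧ P f μ) ∧
    ∀ g ν, IsSpectralCouple p q t₀ g ν → P g ν → EqOn g f (Icc 0 t₀) ∧ ν = μ

/-- `(f, μ)` is the spectral couple on `[0, t₀]` with exactly `n - 1` zeros in `(0, t₀)`. -/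
def IsSpectralCoupleWithZeros (p q t₀ : ℝ) (n : ℕ) : (ℝ → ℝ) → ℝ → Prop :=
  IsTheSpectralCouple p q t₀ (fun g _ => HasPredZeros t₀ n g)

/-- `(f, μ)` is the spectral couple on `[0, t₀]` associated to the `n`-th spectral number. -/
def IsNthSpectralCouple (p q t₀ : ℝ) (n : ℕ) : (ℝ → ℝ) → ℝ → Prop :=
  IsTheSpectralCouple p q t₀ (fun _ ν => IsNthSpectralNumber p q t₀ n ν)

/-- `g` is 2-periodic, odd, and agrees with `f` on `[0, 1]`. -/
def IsOddPeriodicExtension (f g : ℝ → ℝ) : Prop :=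
  Function.Periodic g 2 ∧ Function.Odd g ∧ EqOn g f (Icc 0 1)

end

noncomputable section

/-! With `r` the exponent conjugate to `p` and `v = [u'']^{p-1}`, the equation becomes the system
`u'' = [v]^{r-1}`, `v'' = λ[u]^{q-1}`, where `u` and `v` vanish at both ends. It suffices to find
one positive solution on `[0,1]` and to show that every spectral couple is a rescaling of its odd
periodic extension.

Existence is variational (`exists_green_fixedPoint`). With `G` the Green operator of `-f''`,
maximise `∫ (Gw)^q` over nonnegative continuous `w` in the unit ball of `L^p(0,1)`. Arzelà-Ascoli
gives a maximiser `φ` in the closure of the image of `G`; duality and strict convexity give `φ = Gw`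
with `w` proportional to `(G φ^{q-1})^{r-1}`. Extending by oddness and periodicity yields a global
solution `(U, V)`, where `U` and `V` vanish exactly at the integers and have opposite signs
elsewhere (`exists_isFundamental`).

Rigidity is `IsFundamental.eq_mode`. For a couple `g`, a scaling of amplitude and time makes `U`
match both `g'(0)` and the spectral number; the only initial datum left is the slope of `v`. The
nonlinearities are increasing, so a discrepancy in that slope orders the two solutions at the right
end (`IsSolOn.comparison`). Since `g` and its `v` vanish there, the signs of `U` and `V` would agree
weakly, with `V` nonzero, which is impossible. All initial data therefore agree. The powers need not
be Lipschitz at `0`, but the zeros of `U` and `V` are nondegenerate and this restores uniqueness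
(`IsSolOn.unique`). The right end then corresponds to an integer `k`, and the norm fixes the
amplitude: `g` is the `k`-th mode. It has `k - 1` interior zeros, and its number increases strictly
with `k`, so both indexings coincide. -/

/-! ### Signed powers. -/

theorem signedPow_zero (r : ℝ) : signedPow r 0 = 0 := by simp [signedPow]

theorem signedPow_neg (r x : ℝ) : signedPow r (-x) = -signedPow r x := by
  simp [signedPow, Real.sign_neg]

theorem signedPow_of_pos (r : ℝ) {x : ℝ} (hx : 0 < x) : signedPow r x = x ^ (r - 1) := by
  simp [signedPow, Real.sign_of_pos hx, abs_of_pos hx]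

theorem signedPow_of_nonneg {r x : ℝ} (hr : 1 < r) (hx : 0 ≤ x) :
    signedPow r x = x ^ (r - 1) := by
  rcases hx.eq_or_lt with rfl | h
  · rw [signedPow_zero, Real.zero_rpow (by linarith)]
  · exact signedPow_of_pos r h

theorem signedPow_of_nonpos {r x : ℝ} (hr : 1 < r) (hx : x ≤ 0) :
    signedPow r x = -(-x) ^ (r - 1) := by
  rw [← signedPow_of_nonneg hr (by linarith), signedPow_neg, neg_neg]

theorem signedPow_strictMono {r : ℝ} (hr : 1 < r) : StrictMono (signedPow r) := by
  intro x y hxy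
  have hr' : 0 < r - 1 := by linarith
  rcases le_or_gt 0 x with hx | hx
  · rw [signedPow_of_nonneg hr hx, signedPow_of_nonneg hr (by linarith)]
    exact Real.rpow_lt_rpow hx hxy hr'
  · rcases le_or_gt y 0 with hy | hy
    · rw [signedPow_of_nonpos hr hx.le, signedPow_of_nonpos hr hy]
      exact neg_lt_neg (Real.rpow_lt_rpow (by linarith) (by linarith) hr')
    · rw [signedPow_of_nonpos hr hx.le, signedPow_of_pos r hy]
      have h1 := Real.rpow_pos_of_pos (neg_pos.2 hx) (r - 1)
      have h2 := Real.rpow_pos_of_pos hy (r - 1)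
      linarith

theorem signedPow_mul {r c : ℝ} (hc : 0 < c) (x : ℝ) :
    signedPow r (c * x) = c ^ (r - 1) * signedPow r x := by
  unfold signedPow
  rw [abs_mul, abs_of_pos hc, Real.mul_rpow hc.le (abs_nonneg x)]
  have : Real.sign (c * x) = Real.sign x := by
    rcases lt_trichotomy x 0 with h | rfl | h
    · rw [Real.sign_of_neg h, Real.sign_of_neg (mul_neg_of_pos_of_neg hc h)]
    · simp
    · rw [Real.sign_of_pos h, Real.sign_of_pos (mul_pos hc h)]
  rw [this]; ring

theorem signedPow_pos {r : ℝ} (hr : 1 < r) {x : ℝ} (hx : 0 < x) : 0 < signedPow r x := by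
  simpa [signedPow_zero] using signedPow_strictMono hr hx

/-- Conjugate exponents make the two odd powers mutually inverse, which is what allows passing
between `u''` and `v`. -/
theorem signedPow_signedPow {p r : ℝ} (hp : 1 < p) (hr : 1 < r) (h : (p - 1) * (r - 1) = 1)
    (x : ℝ) : signedPow r (signedPow p x) = x := by
  have key : ∀ y : ℝ, 0 ≤ y → signedPow r (signedPow p y) = y := by
    intro y hy
    rw [signedPow_of_nonneg hp hy, signedPow_of_nonneg hr (Real.rpow_nonneg hy _),
      ← Real.rpow_mul hy, h, Real.rpow_one]
  rcases le_total 0 x with hx | hx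
  · exact key x hx
  · have := key (-x) (by linarith)
    rw [signedPow_neg, signedPow_neg] at this
    linarith

theorem continuous_signedPow {r : ℝ} (hr : 1 < r) : Continuous (signedPow r) := by
  -- Splitting into positive and negative parts replaces the discontinuous sign by two real powers
  -- with nonnegative exponent.
  have h : signedPow r = fun x : ℝ => (max x 0) ^ (r - 1) - (max (-x) 0) ^ (r - 1) := by
    funext x
    have h0 : (0 : ℝ) ^ (r - 1) = 0 := Real.zero_rpow (by linarith)
    rcases le_total 0 x with hx | hx
    · rw [signedPow_of_nonneg hr hx, max_eq_left hx, max_eq_right (by linarith), h0, sub_zero]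
    · rw [signedPow_of_nonpos hr hx, max_eq_right hx, max_eq_left (by linarith), h0, zero_sub]
  rw [h]
  have h0 : 0 ≤ r - 1 := by linarith
  exact ((continuous_id.max continuous_const).rpow_const (fun _ => Or.inr h0)).sub
    ((continuous_neg.max continuous_const).rpow_const (fun _ => Or.inr h0))

/-- Away from zero the signed power is locally Lipschitz. -/
theorem signedPow_locally_lipschitz (r : ℝ) {c : ℝ} (hc : c ≠ 0) :
    ∃ K > 0, ∃ η > 0, ∀ x y : ℝ, |x - c| < η → |y - c| < η →
      |signedPow r x - signedPow r y| ≤ K * |x - y| := by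
  have key : ∀ c : ℝ, 0 < c → ∃ K > 0, ∃ η > 0, ∀ x y : ℝ, |x - c| < η → |y - c| < η →
      |signedPow r x - signedPow r y| ≤ K * |x - y| := by
    intro c hc
    have h1 := Real.hasStrictDerivAt_rpow_const_of_ne hc.ne' (r - 1)
    obtain ⟨K, s, hs, hK⟩ := h1.hasStrictFDerivAt.exists_lipschitzOnWith
    obtain ⟨η, hη, hsub⟩ := Metric.mem_nhds_iff.1 hs
    refine ⟨K + 1, by positivity, min η c, by positivity, fun x y hx hy => ?_⟩
    have hx1 : x ∈ s := hsub (by rw [Metric.mem_ball, Real.dist_eq]; exact hx.trans_le (min_le_left _ _))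
    have hy1 : y ∈ s := hsub (by rw [Metric.mem_ball, Real.dist_eq]; exact hy.trans_le (min_le_left _ _))
    have hx2 := abs_lt.1 (hx.trans_le (min_le_right _ _))
    have hy2 := abs_lt.1 (hy.trans_le (min_le_right _ _))
    rw [signedPow_of_pos r (by linarith), signedPow_of_pos r (by linarith)]
    have := hK.dist_le_mul x hx1 y hy1
    rw [Real.dist_eq, Real.dist_eq] at this
    nlinarith [abs_nonneg (x - y)]
  rcases lt_or_gt_of_ne hc with h | h
  · obtain ⟨K, hK, η, hη, H⟩ := key (-c) (by linarith)
    refine ⟨K, hK, η, hη, fun x y hx hy => ?_⟩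
    have := H (-x) (-y) (by rwa [neg_sub_neg, abs_sub_comm]) (by rwa [neg_sub_neg, abs_sub_comm])
    rwa [signedPow_neg, signedPow_neg, neg_sub_neg, neg_sub_neg, abs_sub_comm, abs_sub_comm y] at this
  · exact key c h

/-! ### The system for `(u, v)` and the comparison principle. -/

/-- `u'' = [v]^{r-1}`, `v'' = l [u]^{q-1}` on `I`, with first derivatives `u₁`, `v₁`. -/
structure IsSolOn (r q l : ℝ) (I : Set ℝ) (u u₁ v v₁ : ℝ → ℝ) : Prop where
  fst : ∀ t ∈ I, HasDerivWithinAt u (u₁ t) I t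
  fst_deriv : ∀ t ∈ I, HasDerivWithinAt u₁ (signedPow r (v t)) I t
  snd : ∀ t ∈ I, HasDerivWithinAt v (v₁ t) I t
  snd_deriv : ∀ t ∈ I, HasDerivWithinAt v₁ (l * signedPow q (u t)) I t

theorem IsSolOn.mono {r q l : ℝ} {I J : Set ℝ} {u u₁ v v₁ : ℝ → ℝ}
    (h : IsSolOn r q l I u u₁ v v₁) (hJ : J ⊆ I) : IsSolOn r q l J u u₁ v v₁ :=
  ⟨fun t ht => (h.fst t (hJ ht)).mono hJ, fun t ht => (h.fst_deriv t (hJ ht)).mono hJ,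
    fun t ht => (h.snd t (hJ ht)).mono hJ, fun t ht => (h.snd_deriv t (hJ ht)).mono hJ⟩

theorem monotoneOn_Icc_of_hasDerivWithinAt {a b : ℝ} {f f' : ℝ → ℝ}
    (hf : ∀ t ∈ Icc a b, HasDerivWithinAt f (f' t) (Icc a b) t)
    (h0 : ∀ t ∈ Ioo a b, 0 ≤ f' t) : MonotoneOn f (Icc a b) := by
  refine monotoneOn_of_hasDerivWithinAt_nonneg (f' := f') (convex_Icc a b)
    (fun t ht => (hf t ht).continuousWithinAt) ?_ ?_
  · intro t ht
    exact (hf t (interior_subset ht)).mono interior_subset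
  · intro t ht
    rw [interior_Icc] at ht
    exact h0 t ht

/-- A convex function lies above its tangent at the left end point. -/
theorem tangent_le_of_second_deriv_nonneg {τ : ℝ} {f f' f'' : ℝ → ℝ}
    (hf : ∀ t ∈ Icc 0 τ, HasDerivWithinAt f (f' t) (Icc 0 τ) t)
    (hf' : ∀ t ∈ Icc 0 τ, HasDerivWithinAt f' (f'' t) (Icc 0 τ) t)
    (h0 : ∀ t ∈ Ioo 0 τ, 0 ≤ f'' t) {t : ℝ} (ht : t ∈ Icc 0 τ) :
    f 0 + f' 0 * t ≤ f t := by
  have m1 := monotoneOn_Icc_of_hasDerivWithinAt hf' h0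
  have h0τ : (0 : ℝ) ∈ Icc 0 τ := ⟨le_rfl, ht.1.trans ht.2⟩
  have m2 : MonotoneOn (fun t => f t - f' 0 * t) (Icc 0 τ) := by
    refine monotoneOn_Icc_of_hasDerivWithinAt (f' := fun t => f' t - f' 0 * 1) ?_ ?_
    · intro s hs
      exact (hf s hs).sub ((hasDerivWithinAt_id s _).const_mul _)
    · intro s hs
      have := m1 h0τ (Ioo_subset_Icc_self hs) hs.1.le
      simp only [mul_one]; linarith
  have := m2 h0τ ht ht.1
  simp only [mul_zero, sub_zero] at this
  linarith

section Comparison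

variable {r q l T : ℝ} {u u₁ v v₁ U U₁ V V₁ : ℝ → ℝ}

/-- The system is cooperative: `v ≤ V` makes `U - u` convex with zero initial data, so `u ≤ U`; this
in turn makes `V - v` convex, hence above its initial tangent. -/
theorem IsSolOn.comparison_step (hr : 1 < r) (hq : 1 < q) (hl : 0 < l)
    (h : IsSolOn r q l (Icc 0 T) u u₁ v v₁) (H : IsSolOn r q l (Icc 0 T) U U₁ V V₁)
    (e1 : u 0 = U 0) (e2 : u₁ 0 = U₁ 0) (e3 : v 0 = V 0) {τ : ℝ} (hτ0 : 0 ≤ τ) (hτ : τ ≤ T)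
    (hle : ∀ t ∈ Ioo 0 τ, v t ≤ V t) :
    u τ ≤ U τ ∧ (V₁ 0 - v₁ 0) * τ ≤ V τ - v τ := by
  have hsub : Icc 0 τ ⊆ Icc 0 T := Icc_subset_Icc_right hτ
  have h' := h.mono hsub
  have H' := H.mono hsub
  have hw : ∀ t ∈ Icc 0 τ, u t ≤ U t := by
    intro t ht
    have := tangent_le_of_second_deriv_nonneg (f := fun t => U t - u t)
      (f' := fun t => U₁ t - u₁ t) (f'' := fun t => signedPow r (V t) - signedPow r (v t))
      (fun t ht => (H'.fst t ht).sub (h'.fst t ht))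
      (fun t ht => (H'.fst_deriv t ht).sub (h'.fst_deriv t ht))
      (fun t ht => sub_nonneg.2 ((signedPow_strictMono hr).monotone (hle t ht))) ht
    simp only [e1, e2] at this
    linarith
  have hτ' : τ ∈ Icc 0 τ := ⟨hτ0, le_rfl⟩
  refine ⟨hw τ hτ', ?_⟩
  have := tangent_le_of_second_deriv_nonneg (f := fun t => V t - v t)
    (f' := fun t => V₁ t - v₁ t) (f'' := fun t => l * signedPow q (U t) - l * signedPow q (u t))
    (fun t ht => (H'.snd t ht).sub (h'.snd t ht))
    (fun t ht => (H'.snd_deriv t ht).sub (h'.snd_deriv t ht))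
    (fun t ht => sub_nonneg.2 (mul_le_mul_of_nonneg_left
      ((signedPow_strictMono hq).monotone (hw t (Ioo_subset_Icc_self ht))) hl.le)) hτ'
  simp only [e3] at this
  linarith

/-- Strict comparison of two solutions which differ initially only in the slope of `v`. -/
theorem IsSolOn.comparison (hr : 1 < r) (hq : 1 < q) (hl : 0 < l) (hT : 0 < T)
    (h : IsSolOn r q l (Icc 0 T) u u₁ v v₁) (H : IsSolOn r q l (Icc 0 T) U U₁ V V₁)
    (e1 : u 0 = U 0) (e2 : u₁ 0 = U₁ 0) (e3 : v 0 = V 0) (hlt : v₁ 0 < V₁ 0) :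
    u T ≤ U T ∧ v T < V T := by
  have h0T : (0 : ℝ) ∈ Icc 0 T := ⟨le_rfl, hT.le⟩
  have hd : HasDerivWithinAt (fun t => V t - v t) (V₁ 0 - v₁ 0) (Icc 0 T) 0 :=
    (H.snd 0 h0T).sub (h.snd 0 h0T)
  -- The positive initial slope of `V - v` starts the ordering just to the right of `0`.
  have hev : ∀ᶠ t in nhdsWithin 0 (Ioi (0 : ℝ)), 0 < V t - v t := by
    have h1 : HasDerivWithinAt (fun t => V t - v t) (V₁ 0 - v₁ 0) (Ioi 0) 0 := by
      refine (hd.mono (Ioc_subset_Icc_self)).mono_of_mem_nhdsWithin ?_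
      exact Ioc_mem_nhdsGT hT
    have h2 := (hasDerivWithinAt_iff_tendsto_slope' (by simp)).1 h1
    filter_upwards [h2.eventually (lt_mem_nhds (sub_pos.2 hlt)), self_mem_nhdsWithin] with t ht ht0
    rw [slope_def_field, e3, sub_self, sub_zero, sub_zero] at ht
    have ht0' : (0 : ℝ) < t := ht0
    exact (div_pos_iff_of_pos_right ht0').1 ht
  obtain ⟨ε, hε, hεs⟩ := mem_nhdsGT_iff_exists_Ioo_subset.1 hev
  have hεpos : (0 : ℝ) < ε := hε
  have hcont : ContinuousOn (fun t => V t - v t) (Icc 0 T) := fun t ht =>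
    ((H.snd t ht).sub (h.snd t ht)).continuousWithinAt
  have hall : ∀ t ∈ Ioc 0 T, 0 < V t - v t := by
    by_contra hcon
    push Not at hcon
    obtain ⟨t₁, ht₁, hneg⟩ := hcon
    -- Cutting at `ε / 2` keeps the set of bad times away from `0`, where `V - v` vanishes anyway;
    -- compactness then gives a first bad time `τ`. Up to `τ` the ordering holds, so the tangent
    -- bound forces `V - v > 0` at `τ`.
    have hcomp : IsCompact ({t ∈ Icc 0 T | V t - v t ≤ 0} ∩ Ici (ε / 2)) := by
      refine IsCompact.inter_right ?_ isClosed_Ici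
      have : {t ∈ Icc 0 T | V t - v t ≤ 0} = Icc 0 T ∩ (fun t => V t - v t) ⁻¹' Iic 0 := rfl
      rw [this]
      exact isCompact_Icc.of_isClosed_subset
        (hcont.preimage_isClosed_of_isClosed isClosed_Icc isClosed_Iic) inter_subset_left
    have hge : ∀ t ∈ Icc 0 T, 0 < t → V t - v t ≤ 0 → ε / 2 ≤ t := by
      intro t _ ht0 hle
      by_contra hlt'
      push Not at hlt'
      have : 0 < V t - v t := hεs ⟨ht0, by linarith⟩
      linarith
    obtain ⟨τ, ⟨⟨hτ1, hτ2⟩, hτ3⟩, hmin⟩ := hcomp.exists_isLeast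
      ⟨t₁, ⟨⟨Ioc_subset_Icc_self ht₁, hneg⟩, hge t₁ (Ioc_subset_Icc_self ht₁) ht₁.1 hneg⟩⟩
    have hτpos : 0 < τ := lt_of_lt_of_le (by linarith) (mem_Ici.1 hτ3)
    have := (h.comparison_step hr hq hl H e1 e2 e3 hτ1.1 hτ1.2 (by
      intro t ht
      by_contra hlt'
      push Not at hlt'
      have ht' : t ∈ Icc 0 T := ⟨ht.1.le, ht.2.le.trans hτ1.2⟩
      have hle : V t - v t ≤ 0 := by linarith
      have := hmin ⟨⟨ht', hle⟩, hge t ht' ht.1 hle⟩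
      linarith [ht.2])).2
    nlinarith [mul_pos (sub_pos.2 hlt) hτpos]
  refine ⟨(h.comparison_step hr hq hl H e1 e2 e3 hT.le le_rfl ?_).1, ?_⟩
  · intro t ht
    linarith [hall t ⟨ht.1, ht.2.le⟩]
  · linarith [hall T ⟨hT, le_rfl⟩]

end Comparison

/-! ### Uniqueness for the initial value problem. -/

/-- Near a point where `v` does not vanish to second order, the signed power is as good as
Lipschitz along curves tangent to `v`. -/
theorem signedPow_sub_le_of_tangent {r : ℝ} (hr : 1 < r) {a d : ℝ} {v V : ℝ → ℝ}
    (hv : HasDerivWithinAt v d (Ici a) a) (hV : HasDerivWithinAt V d (Ici a) a)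
    (e : v a = V a) (hne : V a ≠ 0 ∨ d ≠ 0) {ε : ℝ} (hε : 0 < ε) :
    ∃ δ > 0, ∀ s ∈ Ioc a (a + δ), ∀ M, |v s - V s| ≤ M * (s - a) →
      |signedPow r (v s) - signedPow r (V s)| ≤ ε * M := by
  suffices hs : ∀ᶠ s in nhdsWithin a (Ioi a), ∀ M, |v s - V s| ≤ M * (s - a) →
      |signedPow r (v s) - signedPow r (V s)| ≤ ε * M by
    obtain ⟨b, hb, hsub⟩ := mem_nhdsGT_iff_exists_Ioc_subset.1 hs
    refine ⟨b - a, sub_pos.2 hb, fun s hs => hsub ?_⟩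
    rwa [add_sub_cancel] at hs
  have hpos : ∀ s ∈ Ioi a, ∀ M, |v s - V s| ≤ M * (s - a) → 0 ≤ M := by
    intro s hs M hM
    have h1 : 0 < s - a := sub_pos.2 hs
    exact nonneg_of_mul_nonneg_left ((abs_nonneg _).trans hM) h1
  -- At a simple zero, homogeneity extracts `(s - a)^(r-1)` and leaves difference quotients close to
  -- `d ≠ 0`, where the power is Lipschitz. The extracted factor tends to `0` and yields `ε`.
  by_cases hc : V a = 0
  · have hd : d ≠ 0 := hne.resolve_left (fun h => h hc)
    obtain ⟨K, hK, η, hη, hlip⟩ := signedPow_locally_lipschitz r hd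
    have slope : ∀ f : ℝ → ℝ, HasDerivWithinAt f d (Ici a) a → f a = 0 →
        ∀ᶠ s in nhdsWithin a (Ioi a), |f s / (s - a) - d| < η := by
      intro f hf hfa
      have h2 := (hasDerivWithinAt_iff_tendsto_slope' (by simp)).1 (hf.mono Ioi_subset_Ici_self)
      filter_upwards [h2 (Metric.ball_mem_nhds d hη)] with t ht
      rw [mem_preimage, slope_def_field, hfa, sub_zero, Metric.mem_ball, Real.dist_eq] at ht
      exact ht
    have hsmall : ∀ᶠ s in nhdsWithin a (Ioi a), K * (s - a) ^ (r - 1) < ε := by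
      have : ContinuousAt (fun s : ℝ => K * (s - a) ^ (r - 1)) a := by
        refine continuousAt_const.mul (ContinuousAt.rpow_const (by fun_prop) ?_)
        exact Or.inr (by linarith)
      have h0 : Filter.Tendsto (fun s : ℝ => K * (s - a) ^ (r - 1)) (nhds a) (nhds 0) := by
        have h1 := this.tendsto
        simpa [Real.zero_rpow (by linarith : r - 1 ≠ 0)] using h1
      exact (h0.mono_left nhdsWithin_le_nhds).eventually (gt_mem_nhds hε)
    filter_upwards [slope v hv (e.trans hc), slope V hV hc, hsmall, self_mem_nhdsWithin]
      with s h1 h2 h3 hs M hM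
    have hs0 : 0 < s - a := sub_pos.2 hs
    have hM0 := hpos s hs M hM
    have e1 : v s = (s - a) * (v s / (s - a)) := by field_simp
    have e2 : V s = (s - a) * (V s / (s - a)) := by field_simp
    have hp : 0 ≤ (s - a) ^ (r - 1) := Real.rpow_nonneg hs0.le _
    rw [e1, e2, signedPow_mul hs0, signedPow_mul hs0, ← mul_sub, abs_mul, abs_of_nonneg hp]
    have h4 := hlip _ _ h1 h2
    have h5 : |v s / (s - a) - V s / (s - a)| ≤ M := by
      rw [← sub_div, abs_div, abs_of_pos hs0, div_le_iff₀ hs0]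
      exact hM
    calc (s - a) ^ (r - 1) * |signedPow r (v s / (s - a)) - signedPow r (V s / (s - a))|
        ≤ (s - a) ^ (r - 1) * (K * M) := by
          refine mul_le_mul_of_nonneg_left (h4.trans ?_) hp
          exact mul_le_mul_of_nonneg_left h5 hK.le
      _ = (K * (s - a) ^ (r - 1)) * M := by ring
      _ ≤ ε * M := mul_le_mul_of_nonneg_right h3.le hM0
  -- Away from zeros the power is Lipschitz and the factor `s - a` supplies the smallness.
  · obtain ⟨K, hK, η, hη, hlip⟩ := signedPow_locally_lipschitz r hc
    have near : ∀ f : ℝ → ℝ, HasDerivWithinAt f d (Ici a) a → f a = V a →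
        ∀ᶠ s in nhdsWithin a (Ioi a), |f s - V a| < η := by
      intro f hf hfa
      have h2 := (hf.mono Ioi_subset_Ici_self).continuousWithinAt.tendsto
      rw [hfa] at h2
      filter_upwards [h2 (Metric.ball_mem_nhds _ hη)] with t ht
      rwa [mem_preimage, Metric.mem_ball, Real.dist_eq] at ht
    have hsmall : ∀ᶠ s in nhdsWithin a (Ioi a), K * (s - a) < ε := by
      have h0 : Filter.Tendsto (fun s : ℝ => K * (s - a)) (nhds a) (nhds 0) := by
        have : Continuous (fun s : ℝ => K * (s - a)) := by fun_prop
        simpa using this.tendsto a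
      exact (h0.mono_left nhdsWithin_le_nhds).eventually (gt_mem_nhds hε)
    filter_upwards [near v hv e, near V hV rfl, hsmall, self_mem_nhdsWithin] with s h1 h2 h3 hs M hM
    have hM0 := hpos s hs M hM
    calc |signedPow r (v s) - signedPow r (V s)| ≤ K * |v s - V s| := hlip _ _ h1 h2
      _ ≤ K * (M * (s - a)) := mul_le_mul_of_nonneg_left hM hK.le
      _ = (K * (s - a)) * M := by ring
      _ ≤ ε * M := mul_le_mul_of_nonneg_right h3.le hM0

section Uniqueness

variable {r q l a b : ℝ} {u u₁ v v₁ U U₁ V V₁ : ℝ → ℝ}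

theorem hasDerivWithinAt_Ici_of_Icc {f : ℝ → ℝ} {d : ℝ} (hab : a < b)
    (h : HasDerivWithinAt f d (Icc a b) a) : HasDerivWithinAt f d (Ici a) a :=
  h.mono_of_mem_nhdsWithin (Icc_mem_nhdsGE hab)

/-- A contraction argument: if `M` bounds the differences of the slopes on a short interval, the
functions differ by at most `M * (s - a)`. By the tangent estimate the second derivatives differ by
at most `M / 2`, so `M ≤ M / 2`. -/
theorem IsSolOn.unique_local (hr : 1 < r) (hq : 1 < q) (hl : 0 < l) (hab : a < b)
    (h : IsSolOn r q l (Icc a b) u u₁ v v₁) (H : IsSolOn r q l (Icc a b) U U₁ V V₁)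
    (e1 : u a = U a) (e2 : u₁ a = U₁ a) (e3 : v a = V a) (e4 : v₁ a = V₁ a)
    (n1 : U a ≠ 0 ∨ U₁ a ≠ 0) (n2 : V a ≠ 0 ∨ V₁ a ≠ 0) :
    ∃ c > a, ∀ s ∈ Icc a c, (u s = U s ∧ u₁ s = U₁ s) ∧ v s = V s ∧ v₁ s = V₁ s := by
  have haa : a ∈ Icc a b := ⟨le_rfl, hab.le⟩
  obtain ⟨δ₁, hδ₁, H1⟩ := signedPow_sub_le_of_tangent hr
    (hasDerivWithinAt_Ici_of_Icc hab (e4 ▸ h.snd a haa))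
    (hasDerivWithinAt_Ici_of_Icc hab (H.snd a haa)) e3 n2 (ε := 1 / 2) (by norm_num)
  -- The choice `1 / (2 * l)` absorbs the factor `l` in the equation for `v`.
  obtain ⟨δ₂, hδ₂, H2⟩ := signedPow_sub_le_of_tangent hq
    (hasDerivWithinAt_Ici_of_Icc hab (e2 ▸ h.fst a haa))
    (hasDerivWithinAt_Ici_of_Icc hab (H.fst a haa)) e1 n1 (ε := 1 / (2 * l)) (by positivity)
  obtain ⟨δ, hδ, hδ1, hδ2, hδ3, hδ4⟩ : ∃ δ > 0, δ ≤ δ₁ ∧ δ ≤ δ₂ ∧ δ ≤ 1 ∧ δ ≤ b - a := by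
    refine ⟨min (min δ₁ δ₂) (min 1 (b - a)), ?_, ?_, ?_, ?_, ?_⟩
    · have : 0 < b - a := sub_pos.2 hab
      positivity
    · exact (min_le_left _ _).trans (min_le_left _ _)
    · exact (min_le_left _ _).trans (min_le_right _ _)
    · exact (min_le_right _ _).trans (min_le_left _ _)
    · exact (min_le_right _ _).trans (min_le_right _ _)
  have hsub : Icc a (a + δ) ⊆ Icc a b := Icc_subset_Icc_right (by linarith)
  have h' := h.mono hsub
  have H' := H.mono hsub
  have ha' : a ∈ Icc a (a + δ) := ⟨le_rfl, by linarith⟩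
  have c1 : ContinuousOn (fun s => |u₁ s - U₁ s|) (Icc a (a + δ)) := fun s hs =>
    ((h'.fst_deriv s hs).continuousWithinAt.sub (H'.fst_deriv s hs).continuousWithinAt).abs
  have c2 : ContinuousOn (fun s => |v₁ s - V₁ s|) (Icc a (a + δ)) := fun s hs =>
    ((h'.snd_deriv s hs).continuousWithinAt.sub (H'.snd_deriv s hs).continuousWithinAt).abs
  obtain ⟨x, hx, hmax⟩ := isCompact_Icc.exists_isMaxOn ⟨a, ha'⟩ (c1.sup c2)
  set M := max |u₁ x - U₁ x| |v₁ x - V₁ x| with hM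
  have hM0 : 0 ≤ M := (abs_nonneg _).trans (le_max_left _ _)
  have b1 : ∀ s ∈ Icc a (a + δ), |u₁ s - U₁ s| ≤ M := fun s hs =>
    (le_max_left _ _).trans (hmax hs)
  have b2 : ∀ s ∈ Icc a (a + δ), |v₁ s - V₁ s| ≤ M := fun s hs =>
    (le_max_right _ _).trans (hmax hs)
  have mv : ∀ (f f' : ℝ → ℝ) (C : ℝ), f a = 0 →
      (∀ s ∈ Icc a (a + δ), HasDerivWithinAt f (f' s) (Icc a (a + δ)) s) →
      (∀ s ∈ Icc a (a + δ), |f' s| ≤ C) → ∀ s ∈ Icc a (a + δ), |f s| ≤ C * (s - a) := by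
    intro f f' C hfa hf hC s hs
    have := (convex_Icc a (a + δ)).norm_image_sub_le_of_norm_hasDerivWithin_le hf hC ha' hs
    rwa [hfa, sub_zero, Real.norm_eq_abs, Real.norm_eq_abs,
      abs_of_nonneg (sub_nonneg.2 hs.1)] at this
  have w0 := mv (fun s => u s - U s) _ M (by simp [e1])
    (fun s hs => (h'.fst s hs).sub (H'.fst s hs)) b1
  have z0 := mv (fun s => v s - V s) _ M (by simp [e3])
    (fun s hs => (h'.snd s hs).sub (H'.snd s hs)) b2
  have w1 := mv (fun s => u₁ s - U₁ s) _ (1 / 2 * M) (by simp [e2])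
    (fun s hs => (h'.fst_deriv s hs).sub (H'.fst_deriv s hs)) (by
      intro s hs
      rcases hs.1.eq_or_lt with rfl | has
      · rw [e3, sub_self, abs_zero]; positivity
      · exact H1 s ⟨has, by linarith [hs.2]⟩ M (z0 s hs))
  have z1 := mv (fun s => v₁ s - V₁ s) _ (1 / 2 * M) (by simp [e4])
    (fun s hs => (h'.snd_deriv s hs).sub (H'.snd_deriv s hs)) (by
      intro s hs
      rw [← mul_sub, abs_mul, abs_of_pos hl]
      rcases hs.1.eq_or_lt with rfl | has
      · rw [e1, sub_self, abs_zero, mul_zero]; positivity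
      · calc l * |signedPow q (u s) - signedPow q (U s)| ≤ l * (1 / (2 * l) * M) :=
              mul_le_mul_of_nonneg_left (H2 s ⟨has, by linarith [hs.2]⟩ M (w0 s hs)) hl.le
          _ = 1 / 2 * M := by field_simp)
  have hxd : x - a ≤ 1 := by linarith [hx.2]
  have hM1 : M ≤ 1 / 2 * M := by
    refine max_le ((w1 x hx).trans ?_) ((z1 x hx).trans ?_) <;>
    exact mul_le_of_le_one_right (by positivity) hxd
  have hMz : M = 0 := by linarith
  rw [hMz] at w0 z0 b1 b2
  refine ⟨a + δ, by linarith, fun s hs => ⟨⟨?_, ?_⟩, ?_, ?_⟩⟩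
  · have := w0 s hs
    rw [zero_mul] at this
    exact sub_eq_zero.1 (abs_nonpos_iff.1 this)
  · exact sub_eq_zero.1 (abs_nonpos_iff.1 (b1 s hs))
  · have := z0 s hs
    rw [zero_mul] at this
    exact sub_eq_zero.1 (abs_nonpos_iff.1 this)
  · exact sub_eq_zero.1 (abs_nonpos_iff.1 (b2 s hs))

/-- Uniqueness for the initial value problem, as long as the given solution `(U, V)` has no
degenerate zeros. -/
theorem IsSolOn.unique (hr : 1 < r) (hq : 1 < q) (hl : 0 < l)
    (h : IsSolOn r q l (Icc a b) u u₁ v v₁) (H : IsSolOn r q l (Icc a b) U U₁ V V₁)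
    (e1 : u a = U a) (e2 : u₁ a = U₁ a) (e3 : v a = V a) (e4 : v₁ a = V₁ a)
    (n1 : ∀ t, U t ≠ 0 ∨ U₁ t ≠ 0) (n2 : ∀ t, V t ≠ 0 ∨ V₁ t ≠ 0) :
    ∀ t ∈ Icc a b, (u t = U t ∧ u₁ t = U₁ t) ∧ v t = V t ∧ v₁ t = V₁ t := by
  have hcl : IsClosed ({t | (u t = U t ∧ u₁ t = U₁ t) ∧ v t = V t ∧ v₁ t = V₁ t} ∩ Icc a b) := by
    have key : ∀ f g : ℝ → ℝ, ContinuousOn f (Icc a b) → ContinuousOn g (Icc a b) →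
        IsClosed (Icc a b ∩ {t | f t = g t}) := by
      intro f g hf hg
      have := (hf.sub hg).preimage_isClosed_of_isClosed isClosed_Icc isClosed_singleton (t := {0})
      convert this using 2
      ext t
      simp [sub_eq_zero]
    have k1 := key u U (fun s hs => (h.fst s hs).continuousWithinAt)
      (fun s hs => (H.fst s hs).continuousWithinAt)
    have k2 := key u₁ U₁ (fun s hs => (h.fst_deriv s hs).continuousWithinAt)
      (fun s hs => (H.fst_deriv s hs).continuousWithinAt)
    have k3 := key v V (fun s hs => (h.snd s hs).continuousWithinAt)
      (fun s hs => (H.snd s hs).continuousWithinAt)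
    have k4 := key v₁ V₁ (fun s hs => (h.snd_deriv s hs).continuousWithinAt)
      (fun s hs => (H.snd_deriv s hs).continuousWithinAt)
    convert (k1.inter k2).inter (k3.inter k4) using 1
    ext t
    simp only [mem_inter_iff, mem_ofPred_eq]
    tauto
  -- Continuous induction: the set of agreement is closed, and local uniqueness extends it to the
  -- right.
  refine hcl.Icc_subset_of_forall_mem_nhdsWithin ⟨⟨e1, e2⟩, e3, e4⟩ ?_
  rintro t ⟨⟨⟨f1, f2⟩, f3, f4⟩, ht⟩
  have hsub : Icc t b ⊆ Icc a b := Icc_subset_Icc_left ht.1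
  obtain ⟨c, hc, hs⟩ := (h.mono hsub).unique_local hr hq hl ht.2 (H.mono hsub) f1 f2 f3 f4
    (n1 t) (n2 t)
  exact Filter.mem_of_superset (Ioc_mem_nhdsGT hc) (fun s hs' => hs s (Ioc_subset_Icc_self hs'))

end Uniqueness

/-! ### The Green operator of `-f''` on `[0,1]`. -/

/-- The primitive of `h` vanishing at `0`. -/
def primitive (h : ℝ → ℝ) (t : ℝ) : ℝ := ∫ s in (0 : ℝ)..t, h s

/-- The solution of `-f'' = h`, `f(0) = f(1) = 0`. -/
def green (h : ℝ → ℝ) (t : ℝ) : ℝ :=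
  t * primitive (primitive h) 1 - primitive (primitive h) t

/-- The derivative of `green h`. -/
def greenDeriv (h : ℝ → ℝ) (t : ℝ) : ℝ := primitive (primitive h) 1 - primitive h t

section Green

variable {h k : ℝ → ℝ}

theorem hasDerivAt_primitive (hh : Continuous h) (t : ℝ) : HasDerivAt (primitive h) (h t) t :=
  intervalIntegral.integral_hasDerivAt_right (hh.intervalIntegrable _ _)
    (hh.stronglyMeasurableAtFilter _ _) hh.continuousAt

theorem continuous_primitive (hh : Continuous h) : Continuous (primitive h) :=
  continuous_iff_continuousAt.2 fun t => (hasDerivAt_primitive hh t).continuousAt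

theorem hasDerivAt_green (hh : Continuous h) (t : ℝ) :
    HasDerivAt (green h) (greenDeriv h t) t := by
  have := ((hasDerivAt_id t).mul_const (primitive (primitive h) 1)).sub
    (hasDerivAt_primitive (continuous_primitive hh) t)
  rw [one_mul] at this
  exact this

theorem hasDerivAt_greenDeriv (hh : Continuous h) (t : ℝ) :
    HasDerivAt (greenDeriv h) (-h t) t := by
  exact (hasDerivAt_primitive hh t).const_sub (primitive (primitive h) 1)

theorem continuous_green (hh : Continuous h) : Continuous (green h) :=
  continuous_iff_continuousAt.2 fun t => (hasDerivAt_green hh t).continuousAt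

@[simp] theorem green_zero (h : ℝ → ℝ) : green h 0 = 0 := by simp [green, primitive]

@[simp] theorem green_one (h : ℝ → ℝ) : green h 1 = 0 := by simp [green]

theorem concaveOn_green (hh : Continuous h) (h0 : ∀ t ∈ Icc (0 : ℝ) 1, 0 ≤ h t) :
    ConcaveOn ℝ (Icc 0 1) (green h) := by
  refine concaveOn_of_hasDerivWithinAt2_nonpos (f' := greenDeriv h) (f'' := fun t => -h t)
    (convex_Icc 0 1) (continuous_green hh).continuousOn
    (fun t _ => (hasDerivAt_green hh t).hasDerivWithinAt)
    (fun t _ => (hasDerivAt_greenDeriv hh t).hasDerivWithinAt) ?_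
  intro t ht
  exact neg_nonpos.2 (h0 t (interior_subset ht))

theorem green_nonneg (hh : Continuous h) (h0 : ∀ t ∈ Icc (0 : ℝ) 1, 0 ≤ h t) {t : ℝ}
    (ht : t ∈ Icc (0 : ℝ) 1) : 0 ≤ green h t := by
  have := (concaveOn_green hh h0).2 (x := 0) (by simp) (y := 1) (by simp)
    (sub_nonneg.2 ht.2) ht.1 (by ring)
  simpa using this

/-- A concave function lies above the chords joining its value at `x` to the zeros at `0` and `1`.
-/
theorem green_pos (hh : Continuous h) (h0 : ∀ t ∈ Icc (0 : ℝ) 1, 0 ≤ h t) {x : ℝ}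
    (hx : x ∈ Icc (0 : ℝ) 1) (hxpos : 0 < green h x) {t : ℝ} (ht : t ∈ Ioo (0 : ℝ) 1) :
    0 < green h t := by
  have hc := (concaveOn_green hh h0).2
  have hx0 : 0 < x := hx.1.lt_of_ne (by rintro rfl; simp at hxpos)
  have hx1 : x < 1 := hx.2.lt_of_ne (by rintro rfl; simp at hxpos)
  rcases le_total t x with htx | htx
  · have := hc (x := 0) (by simp) (y := x) hx (a := 1 - t / x) (b := t / x)
      (sub_nonneg.2 ((div_le_one hx0).2 htx)) (div_nonneg ht.1.le hx0.le) (by ring)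
    simp only [green_zero, smul_eq_mul, mul_zero, zero_add, div_mul_cancel₀ _ hx0.ne'] at this
    exact (mul_pos (div_pos ht.1 hx0) hxpos).trans_le this
  · have h1x : 0 < 1 - x := sub_pos.2 hx1
    have h1t : 0 < 1 - t := sub_pos.2 ht.2
    have := hc (x := x) hx (y := 1) (by simp) (a := (1 - t) / (1 - x)) (b := (t - x) / (1 - x))
      (div_nonneg h1t.le h1x.le) (div_nonneg (sub_nonneg.2 htx) h1x.le) (by field_simp; ring)
    simp only [green_one, smul_eq_mul, mul_zero, add_zero, mul_one] at this
    have e : (1 - t) / (1 - x) * x + (t - x) / (1 - x) = t := by field_simp; ring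
    rw [e] at this
    exact (mul_pos (div_pos h1t h1x) hxpos).trans_le this

/-- The Green operator is symmetric. -/
theorem integral_green_mul (hh : Continuous h) (hk : Continuous k) :
    ∫ t in (0 : ℝ)..1, green h t * k t = ∫ t in (0 : ℝ)..1, h t * green k t := by
  -- The Wronskian-type expression vanishes at both end points, so its derivative integrates to
  -- zero.
  have hd : ∀ t, HasDerivAt (fun t => greenDeriv h t * green k t - green h t * greenDeriv k t)
      (green h t * k t - h t * green k t) t := by
    intro t
    have := ((hasDerivAt_greenDeriv hh t).mul (hasDerivAt_green hk t)).sub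
      ((hasDerivAt_green hh t).mul (hasDerivAt_greenDeriv hk t))
    exact this.congr_deriv (by ring)
  have i1 : Continuous fun t => green h t * k t := (continuous_green hh).mul hk
  have i2 : Continuous fun t => h t * green k t := hh.mul (continuous_green hk)
  have := intervalIntegral.integral_eq_sub_of_hasDerivAt (a := 0) (b := 1) (fun t _ => hd t)
    ((i1.sub i2).intervalIntegrable _ _)
  rw [intervalIntegral.integral_sub (i1.intervalIntegrable _ _) (i2.intervalIntegrable _ _)] at this
  simp only [green_zero, green_one, mul_zero, zero_mul, sub_zero] at this
  linarith

theorem primitive_mono (hh : Continuous h) (h0 : ∀ t ∈ Icc (0 : ℝ) 1, 0 ≤ h t) :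
    MonotoneOn (primitive h) (Icc 0 1) :=
  monotoneOn_Icc_of_hasDerivWithinAt (fun t _ => (hasDerivAt_primitive hh t).hasDerivWithinAt)
    (fun t ht => h0 t (Ioo_subset_Icc_self ht))

/-- Both terms of `greenDeriv h t` lie in `[0, primitive h 1]`. This is the source of
equicontinuity. -/
theorem abs_greenDeriv_le (hh : Continuous h) (h0 : ∀ t ∈ Icc (0 : ℝ) 1, 0 ≤ h t) {t : ℝ}
    (ht : t ∈ Icc (0 : ℝ) 1) : |greenDeriv h t| ≤ primitive h 1 := by
  have hm := primitive_mono hh h0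
  have hb : ∀ s ∈ Icc (0 : ℝ) 1, 0 ≤ primitive h s ∧ primitive h s ≤ primitive h 1 := by
    intro s hs
    refine ⟨?_, hm hs (by simp) hs.2⟩
    have := hm (by simp) hs hs.1
    simpa [primitive] using this
  have hc := continuous_primitive hh
  have l1 : 0 ≤ primitive (primitive h) 1 :=
    intervalIntegral.integral_nonneg zero_le_one fun s hs => (hb s hs).1
  have l2 : primitive (primitive h) 1 ≤ primitive h 1 := by
    have := intervalIntegral.integral_mono_on (μ := volume) (a := 0) (b := 1) zero_le_one
      (hc.intervalIntegrable _ _) (intervalIntegrable_const (c := primitive h 1))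
      (fun s hs => (hb s hs).2)
    rwa [intervalIntegral.integral_const, sub_zero, one_smul] at this
  unfold greenDeriv
  rw [abs_le]
  constructor <;> linarith [(hb t ht).1, (hb t ht).2]

theorem abs_green_sub_le (hh : Continuous h) (h0 : ∀ t ∈ Icc (0 : ℝ) 1, 0 ≤ h t) {s t : ℝ}
    (hs : s ∈ Icc (0 : ℝ) 1) (ht : t ∈ Icc (0 : ℝ) 1) :
    |green h t - green h s| ≤ primitive h 1 * |t - s| :=
  (convex_Icc (0 : ℝ) 1).norm_image_sub_le_of_norm_hasDerivWithin_le
    (fun x _ => (hasDerivAt_green hh x).hasDerivWithinAt)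
    (fun _ hx => abs_greenDeriv_le hh h0 hx) hs ht

end Green

/-! ### The variational problem and its positive maximiser. -/

section Existence

/-- The nonnegative part of the unit ball of `L^p(0,1)`, restricted to continuous functions. -/
structure IsAdmissible (p : ℝ) (w : ℝ → ℝ) : Prop where
  continuous : Continuous w
  nonneg : ∀ t ∈ Icc (0 : ℝ) 1, 0 ≤ w t
  integral_le : ∫ t in (0 : ℝ)..1, w t ^ p ≤ 1

variable {p q r : ℝ}

/-- Integrate `x ≤ 1 + x^p`. The constant is not sharp; only uniformity in `w` matters. -/
theorem IsAdmissible.primitive_le (hp : 1 < p) {w : ℝ → ℝ} (hw : IsAdmissible p w) :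
    primitive w 1 ≤ 2 := by
  have hc : Continuous fun t => w t ^ p :=
    hw.continuous.rpow_const (fun _ => Or.inr (by linarith))
  have h1 : primitive w 1 ≤ ∫ t in (0 : ℝ)..1, (1 + w t ^ p) := by
    refine intervalIntegral.integral_mono_on zero_le_one (hw.continuous.intervalIntegrable _ _)
      ((continuous_const.add hc).intervalIntegrable _ _) fun t ht => ?_
    have h0 := hw.nonneg t ht
    rcases le_total (w t) 1 with h | h
    · linarith [Real.rpow_nonneg h0 p]
    · linarith [Real.self_le_rpow_of_one_le h hp.le]
  rw [intervalIntegral.integral_add (by simp) (hc.intervalIntegrable _ _)] at h1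
  simp only [intervalIntegral.integral_const, sub_zero, smul_eq_mul, mul_one] at h1
  linarith [hw.integral_le]

/-- `green w` as an element of `C([0,1])`. -/
def greenBCF (w : ℝ → ℝ) (hw : Continuous w) : BoundedContinuousFunction (Icc (0 : ℝ) 1) ℝ :=
  BoundedContinuousFunction.mkOfCompact
    ⟨fun t => green w t, (continuous_green hw).comp continuous_subtype_val⟩

/-- The image of the admissible functions under the Green operator. -/
def greenImage (p : ℝ) : Set (BoundedContinuousFunction (Icc (0 : ℝ) 1) ℝ) :=
  {φ | ∃ w, ∃ hw : IsAdmissible p w, φ = greenBCF w hw.continuous}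

/-- Arzelà-Ascoli: the bound `2` on `primitive w 1` is a common Lipschitz constant, and all
functions vanish at `0`. -/
theorem isCompact_closure_greenImage (hp : 1 < p) : IsCompact (closure (greenImage p)) := by
  refine BoundedContinuousFunction.arzela_ascoli (Icc (-2) 2) isCompact_Icc _ ?_ ?_
  · rintro _ t ⟨w, hw, rfl⟩
    have h1 := abs_green_sub_le hw.continuous hw.nonneg (s := 0) (by simp) t.2
    rw [green_zero, sub_zero, sub_zero, abs_of_nonneg t.2.1] at h1
    have h2 := hw.primitive_le hp
    refine abs_le.1 (h1.trans ?_)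
    nlinarith [t.2.1, t.2.2]
  · refine (LipschitzWith.uniformEquicontinuous _ 2 ?_).equicontinuous
    rintro ⟨_, w, hw, rfl⟩
    refine LipschitzWith.of_dist_le_mul fun s t => ?_
    have h1 := abs_green_sub_le hw.continuous hw.nonneg t.2 s.2
    rw [Subtype.dist_eq, Real.dist_eq, Real.dist_eq]
    exact h1.trans (mul_le_mul_of_nonneg_right (by simpa using hw.primitive_le hp) (abs_nonneg _))

/-- The extension of `φ` to the real line which is constant outside `[0,1]`. -/
def extendIcc (φ : BoundedContinuousFunction (Icc (0 : ℝ) 1) ℝ) (t : ℝ) : ℝ :=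
  φ (projIcc 0 1 zero_le_one t)

theorem continuous_extendIcc (φ : BoundedContinuousFunction (Icc (0 : ℝ) 1) ℝ) :
    Continuous (extendIcc φ) := φ.continuous.comp continuous_projIcc

theorem continuous_uncurry_extendIcc : Continuous (Function.uncurry extendIcc) := by
  have : Continuous fun x : BoundedContinuousFunction (Icc (0 : ℝ) 1) ℝ × Icc (0 : ℝ) 1 =>
    x.1 x.2 := ContinuousEval.continuous_eval
  exact this.comp (continuous_fst.prodMk ((continuous_projIcc (h := zero_le_one)).comp continuous_snd))

theorem extendIcc_greenBCF {w : ℝ → ℝ} (hw : Continuous w) {t : ℝ} (ht : t ∈ Icc (0 : ℝ) 1) :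
    extendIcc (greenBCF w hw) t = green w t := by
  show green w (projIcc 0 1 zero_le_one t) = green w t
  rw [projIcc_of_mem zero_le_one ht]

theorem extendIcc_nonneg_of_mem_closure {φ : BoundedContinuousFunction (Icc (0 : ℝ) 1) ℝ}
    (hφ : φ ∈ closure (greenImage p)) (t : ℝ) : 0 ≤ extendIcc φ t := by
  have hcl : IsClosed {φ : BoundedContinuousFunction (Icc (0 : ℝ) 1) ℝ | 0 ≤ extendIcc φ t} :=
    isClosed_le continuous_const
      (continuous_uncurry_extendIcc.comp (continuous_id.prodMk continuous_const))
  refine closure_minimal ?_ hcl hφ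
  rintro _ ⟨w, hw, rfl⟩
  exact green_nonneg hw.continuous hw.nonneg (projIcc (0 : ℝ) 1 zero_le_one t).2

/-- The maximum is sought on the compact closure, so `φ` is at first only a uniform limit of
functions `green w`; that it has this form itself is recovered later on. -/
theorem exists_isMaxOn_greenImage (hp : 1 < p) (hq : 1 < q) :
    ∃ φ ∈ closure (greenImage p), ∀ w, IsAdmissible p w →
      ∫ t in (0 : ℝ)..1, green w t ^ q ≤ ∫ t in (0 : ℝ)..1, extendIcc φ t ^ q := by
  have hne : (closure (greenImage p)).Nonempty := by
    refine ⟨greenBCF 0 continuous_zero, subset_closure ⟨0, ⟨continuous_zero, ?_, ?_⟩, rfl⟩⟩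
    · simp
    · simp [Real.zero_rpow (by linarith : p ≠ 0)]
  have hcont : Continuous fun φ : BoundedContinuousFunction (Icc (0 : ℝ) 1) ℝ =>
      ∫ t in (0 : ℝ)..1, extendIcc φ t ^ q := by
    refine intervalIntegral.continuous_parametric_intervalIntegral_of_continuous'
      (f := fun φ t => extendIcc φ t ^ q) ?_ 0 1
    exact continuous_uncurry_extendIcc.rpow_const (fun _ => Or.inr (by linarith))
  obtain ⟨φ, hφ, hmax⟩ := (isCompact_closure_greenImage hp).exists_isMaxOn hne hcont.continuousOn
  refine ⟨φ, hφ, fun w hw => ?_⟩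
  have h1 := isMaxOn_iff.1 hmax _ (subset_closure (s := greenImage p) ⟨w, hw, rfl⟩)
  refine le_trans (le_of_eq ?_) h1
  refine intervalIntegral.integral_congr fun t ht => ?_
  rw [uIcc_of_le zero_le_one] at ht
  simp only [extendIcc_greenBCF hw.continuous ht]

/-- Strict convexity of `x ↦ x ^ q`. -/
theorem rpow_tangent_lt (hq : 1 < q) {a b : ℝ} (ha : 0 ≤ a) (hb : 0 ≤ b) (hab : a ≠ b) :
    b ^ q + q * (b ^ (q - 1) * (a - b)) < a ^ q := by
  rcases hb.eq_or_lt with rfl | hb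
  · rw [Real.zero_rpow (by linarith), Real.zero_rpow (by linarith)]
    simpa using Real.rpow_pos_of_pos (ha.lt_of_ne hab.symm) q
  · have h1 := one_add_mul_self_lt_rpow_one_add (s := a / b - 1)
      (by linarith [div_nonneg ha hb.le])
      (by rw [Ne, sub_eq_zero, div_eq_one_iff_eq hb.ne']; exact hab) hq
    rw [add_sub_cancel, Real.div_rpow ha hb.le, lt_div_iff₀ (Real.rpow_pos_of_pos hb q)] at h1
    have h2 : b ^ q = b ^ (q - 1) * b := by
      rw [← Real.rpow_add_one hb.ne', sub_add_cancel]
    refine lt_of_eq_of_lt ?_ h1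
    rw [h2]; field_simp

theorem rpow_tangent_le (hq : 1 < q) {a b : ℝ} (ha : 0 ≤ a) (hb : 0 ≤ b) :
    b ^ q + q * (b ^ (q - 1) * (a - b)) ≤ a ^ q := by
  rcases eq_or_ne a b with rfl | h
  · simp
  · exact (rpow_tangent_lt hq ha hb h).le

theorem exists_pos_of_integral_pos {f : ℝ → ℝ} (hf : 0 < ∫ t in (0 : ℝ)..1, f t) :
    ∃ t ∈ Icc (0 : ℝ) 1, 0 < f t := by
  by_contra! hcon
  have h0 := intervalIntegral.integral_nonneg (μ := volume) zero_le_one (f := fun t => -f t)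
    (fun t ht => neg_nonneg.2 (hcon t ht))
  rw [intervalIntegral.integral_neg] at h0
  linarith

/-- The duality pairing with the unit ball of `L^p`. -/
theorem integral_mul_le_of_isAdmissible (hpr : r.HolderConjugate p) {v w : ℝ → ℝ}
    (hv : Continuous v) (hv0 : ∀ t ∈ Icc (0 : ℝ) 1, 0 ≤ v t)
    (hN : 0 < ∫ t in (0 : ℝ)..1, v t ^ r) (hw : IsAdmissible p w) :
    ∫ t in (0 : ℝ)..1, v t * w t ≤ (∫ t in (0 : ℝ)..1, v t ^ r) ^ (1 / r) := by
  set N := ∫ t in (0 : ℝ)..1, v t ^ r with hNdef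
  have hκ : 0 < N ^ (1 / r) := Real.rpow_pos_of_pos hN _
  set κ := N ^ (1 / r) with hκdef
  have hr := hpr.pos
  have hp := hpr.symm.pos
  have hκr : κ ^ r = N := by
    rw [hκdef, ← Real.rpow_mul hN.le, one_div_mul_cancel hr.ne', Real.rpow_one]
  have cv : Continuous fun t => v t ^ r := hv.rpow_const (fun _ => Or.inr hr.le)
  have cw : Continuous fun t => w t ^ p := hw.continuous.rpow_const (fun _ => Or.inr hp.le)
  have h1 : ∫ t in (0 : ℝ)..1, v t * w t ≤
      ∫ t in (0 : ℝ)..1, (κ / (r * N) * v t ^ r + κ / p * w t ^ p) := by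
    refine intervalIntegral.integral_mono_on zero_le_one
      ((hv.mul hw.continuous).intervalIntegrable _ _)
      (((continuous_const.mul cv).add (continuous_const.mul cw)).intervalIntegrable _ _)
      fun t ht => ?_
    -- Young's inequality is applied to `v / κ` and `w`; since `κ ^ r = N`, the two integrated terms
    -- add up to at most `κ`.
    have := Real.young_inequality_of_nonneg (div_nonneg (hv0 t ht) hκ.le) (hw.nonneg t ht) hpr
    rw [Real.div_rpow (hv0 t ht) hκ.le, hκr] at this
    calc v t * w t = κ * (v t / κ * w t) := by field_simp
      _ ≤ κ * (v t ^ r / N / r + w t ^ p / p) := mul_le_mul_of_nonneg_left this hκ.le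
      _ = κ / (r * N) * v t ^ r + κ / p * w t ^ p := by field_simp
  have i1 : IntervalIntegrable (fun t => κ / (r * N) * v t ^ r) volume 0 1 :=
    (continuous_const.mul cv).intervalIntegrable _ _
  have i2 : IntervalIntegrable (fun t => κ / p * w t ^ p) volume 0 1 :=
    (continuous_const.mul cw).intervalIntegrable _ _
  rw [intervalIntegral.integral_add i1 i2, intervalIntegral.integral_const_mul,
    intervalIntegral.integral_const_mul, ← hNdef] at h1
  have h2 : κ / (r * N) * N = κ * r⁻¹ := by field_simp
  have h3 : κ / p * ∫ t in (0 : ℝ)..1, w t ^ p ≤ κ * p⁻¹ := by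
    rw [div_eq_mul_inv]
    exact mul_le_of_le_one_right (by positivity) hw.integral_le
  have h4 := hpr.inv_add_inv_eq_one
  calc _ ≤ _ := h1
    _ ≤ κ * r⁻¹ + κ * p⁻¹ := by rw [h2]; linarith
    _ = κ := by rw [← mul_add, h4, mul_one]

/-- The positive solution of the Euler-Lagrange equation, in integrated form. -/
theorem exists_green_fixedPoint (hp : 1 < p) (hq : 1 < q) (hpr : r.HolderConjugate p) :
    ∃ (φ : ℝ → ℝ) (c : ℝ), Continuous φ ∧ (∀ t, 0 ≤ φ t) ∧ 0 < c ∧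
      (∃ t ∈ Icc (0 : ℝ) 1, 0 < φ t) ∧
      (∀ t ∈ Icc (0 : ℝ) 1,
        φ t = green (fun s => c * green (fun x => φ x ^ (q - 1)) s ^ (r - 1)) t) ∧
      ∫ t in (0 : ℝ)..1, (c * green (fun x => φ x ^ (q - 1)) t ^ (r - 1)) ^ p = 1 := by
  obtain ⟨φ₀, hφ₀, hmax⟩ := exists_isMaxOn_greenImage hp hq
  set φ := extendIcc φ₀ with hφdef
  have cφ : Continuous φ := continuous_extendIcc φ₀
  have φ0 : ∀ t, 0 ≤ φ t := extendIcc_nonneg_of_mem_closure hφ₀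
  set h : ℝ → ℝ := fun x => φ x ^ (q - 1) with hh
  have ch : Continuous h := cφ.rpow_const (fun _ => Or.inr (by linarith))
  have h0 : ∀ t, 0 ≤ h t := fun t => Real.rpow_nonneg (φ0 t) _
  set v := green h with hv
  have cv : Continuous v := continuous_green ch
  have v0 : ∀ t ∈ Icc (0 : ℝ) 1, 0 ≤ v t := fun t ht => green_nonneg ch (fun t _ => h0 t) ht
  have hr := hpr.lt
  have hφq : ∀ t, h t * φ t = φ t ^ q := by
    intro t
    rcases (φ0 t).eq_or_lt with e | e
    · rw [← e, mul_zero, Real.zero_rpow (by linarith)]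
    · rw [hh, ← Real.rpow_add_one e.ne', sub_add_cancel]
  -- By symmetry of the Green operator, `∫ v w = ∫ h (green w)`. A bound on this linear functional
  -- over the image passes to the closure, hence to `φ`, where its value is `∫ φ ^ q`.
  have clos : ∀ C : ℝ, (∀ w, IsAdmissible p w → ∫ t in (0 : ℝ)..1, v t * w t ≤ C) →
      ∫ t in (0 : ℝ)..1, φ t ^ q ≤ C := by
    intro C hC
    have hcont : Continuous fun ψ : BoundedContinuousFunction (Icc (0 : ℝ) 1) ℝ =>
        ∫ t in (0 : ℝ)..1, h t * extendIcc ψ t := by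
      refine intervalIntegral.continuous_parametric_intervalIntegral_of_continuous'
        (f := fun ψ t => h t * extendIcc ψ t) ?_ 0 1
      exact (ch.comp continuous_snd).mul continuous_uncurry_extendIcc
    have hcl := isClosed_le hcont (continuous_const (y := C))
    have := closure_minimal (s := greenImage p) (by
      rintro _ ⟨w, hw, rfl⟩
      have e1 : ∫ t in (0 : ℝ)..1, h t * extendIcc (greenBCF w hw.continuous) t =
          ∫ t in (0 : ℝ)..1, h t * green w t := by
        refine intervalIntegral.integral_congr fun t ht => ?_
        rw [uIcc_of_le zero_le_one] at ht
        simp only [extendIcc_greenBCF hw.continuous ht]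
      rw [mem_ofPred_eq, e1, ← integral_green_mul ch hw.continuous]
      exact hC w hw) hcl hφ₀
    have h2 : ∫ t in (0 : ℝ)..1, h t * φ t ≤ C := this
    simpa only [hφq] using h2
  have Jpos : 0 < ∫ t in (0 : ℝ)..1, φ t ^ q := by
    have hone : IsAdmissible p 1 := ⟨continuous_one, by simp, by simp⟩
    refine lt_of_lt_of_le ?_ (hmax 1 hone)
    have hg : ∀ t ∈ Icc (0 : ℝ) 1, 0 ≤ green 1 t := fun t ht =>
      green_nonneg continuous_one (by simp) ht
    refine intervalIntegral.integral_pos zero_lt_one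
      ((continuous_green continuous_one).rpow_const
        (fun _ => Or.inr (by linarith))).continuousOn
      (fun t ht => Real.rpow_nonneg (hg t (Ioc_subset_Icc_self ht)) _) ⟨1 / 2, by norm_num, ?_⟩
    refine Real.rpow_pos_of_pos ?_ _
    have e1 : primitive 1 = fun t => t := by
      funext t; simp [primitive]
    have e2 : primitive (fun t => t) = fun t => t ^ 2 / 2 := by
      funext t; simp [primitive]
    rw [green, e1, e2]; norm_num
  have cvr : Continuous fun t => v t ^ r := cv.rpow_const (fun _ => Or.inr hpr.pos.le)
  have Npos : 0 < ∫ t in (0 : ℝ)..1, v t ^ r := by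
    refine intervalIntegral.integral_pos zero_lt_one cvr.continuousOn
      (fun t ht => Real.rpow_nonneg (v0 t (Ioc_subset_Icc_self ht)) _) ?_
    -- If `v` vanished identically, `clos` with `C = 0` would contradict `Jpos`.
    by_contra! hcon
    have vz : ∀ t ∈ Icc (0 : ℝ) 1, v t = 0 := by
      intro t ht
      by_contra hne
      exact absurd (Real.rpow_pos_of_pos ((v0 t ht).lt_of_ne' hne) r) (not_lt.2 (hcon t ht))
    have := clos 0 (fun w _ => by
      refine le_of_eq (intervalIntegral.integral_zero_ae ?_)
      filter_upwards with t ht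
      rw [uIoc_of_le zero_le_one] at ht
      rw [vz t (Ioc_subset_Icc_self ht), zero_mul])
    linarith
  set N := ∫ t in (0 : ℝ)..1, v t ^ r with hN
  -- This `c` normalises the integral of `w ^ p`, because `(v ^ (r-1)) ^ p = v ^ r`; the resulting
  -- `w` gives equality in the duality bound.
  set c := (N ^ (1 / p))⁻¹ with hc
  have hcpos : 0 < c := inv_pos.2 (Real.rpow_pos_of_pos Npos _)
  have hp0 : 0 < p := by linarith
  have hcp : c ^ p = N⁻¹ := by
    rw [hc, Real.inv_rpow (Real.rpow_nonneg Npos.le _), ← Real.rpow_mul Npos.le,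
      one_div_mul_cancel hp0.ne', Real.rpow_one]
  set w : ℝ → ℝ := fun s => c * v s ^ (r - 1) with hw
  have cw : Continuous w := continuous_const.mul (cv.rpow_const (fun _ => Or.inr (by linarith)))
  have hwp : ∫ t in (0 : ℝ)..1, w t ^ p = 1 := by
    have : ∫ t in (0 : ℝ)..1, w t ^ p = ∫ t in (0 : ℝ)..1, N⁻¹ * v t ^ r := by
      refine intervalIntegral.integral_congr fun t ht => ?_
      rw [uIcc_of_le zero_le_one] at ht
      simp only [hw]
      rw [Real.mul_rpow hcpos.le (Real.rpow_nonneg (v0 t ht) _), hcp,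
        ← Real.rpow_mul (v0 t ht), hpr.sub_one_mul_conj]
    rw [this, intervalIntegral.integral_const_mul, ← hN, inv_mul_cancel₀ Npos.ne']
  have adm : IsAdmissible p w :=
    ⟨cw, fun t ht => mul_nonneg hcpos.le (Real.rpow_nonneg (v0 t ht) _), hwp.le⟩
  have hvw : ∫ t in (0 : ℝ)..1, v t * w t = N ^ (1 / r) := by
    have : ∫ t in (0 : ℝ)..1, v t * w t = ∫ t in (0 : ℝ)..1, c * v t ^ r := by
      refine intervalIntegral.integral_congr fun t ht => ?_
      rw [uIcc_of_le zero_le_one] at ht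
      simp only [hw]
      rcases (v0 t ht).eq_or_lt with e | e
      · rw [← e, Real.zero_rpow hpr.ne_zero]; simp
      · have : v t ^ r = v t ^ (r - 1) * v t := by
          rw [← Real.rpow_add_one e.ne', sub_add_cancel]
        rw [this]; ring
    rw [this, intervalIntegral.integral_const_mul, ← hN, hc, ← Real.rpow_neg Npos.le,
      ← Real.rpow_add_one Npos.ne']
    congr 1
    have := hpr.inv_add_inv_eq_one
    rw [one_div, one_div]; linarith
  have hle : ∫ t in (0 : ℝ)..1, φ t ^ q ≤ ∫ t in (0 : ℝ)..1, h t * green w t := by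
    rw [← integral_green_mul ch cw, ← hv, hvw]
    exact clos _ fun w' hw' => integral_mul_le_of_isAdmissible hpr cv v0 Npos hw'
  have gw0 : ∀ t ∈ Icc (0 : ℝ) 1, 0 ≤ green w t := fun t ht =>
    green_nonneg cw adm.nonneg ht
  have cg := continuous_green cw
  have cgq : Continuous fun t => green w t ^ q := cg.rpow_const (fun _ => Or.inr (by linarith))
  have cφq : Continuous fun t => φ t ^ q := cφ.rpow_const (fun _ => Or.inr (by linarith))
  -- Otherwise strict convexity gives `∫ (green w)^q > ∫ φ^q + q (∫ h (green w) - ∫ φ^q)`, whose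
  -- right side is at least `∫ φ^q` by `hle`, against maximality.
  have heq : ∀ t ∈ Icc (0 : ℝ) 1, green w t = φ t := by
    by_contra! hcon
    obtain ⟨x, hx, hne⟩ := hcon
    have cl : Continuous fun t => q * (h t * (green w t - φ t)) :=
      continuous_const.mul (ch.mul (cg.sub cφ))
    have pos : 0 < ∫ t in (0 : ℝ)..1, (green w t ^ q - (φ t ^ q + q * (h t * (green w t - φ t)))) := by
      refine intervalIntegral.integral_pos zero_lt_one (cgq.sub (cφq.add cl)).continuousOn
        (fun t ht => ?_) ⟨x, hx, ?_⟩
      · exact sub_nonneg.2 (rpow_tangent_le hq (gw0 t (Ioc_subset_Icc_self ht)) (φ0 t))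
      · exact sub_pos.2 (rpow_tangent_lt hq (gw0 x hx) (φ0 x) hne)
    have i1 : IntervalIntegrable (fun t => φ t ^ q + q * (h t * (green w t - φ t))) volume 0 1 :=
      (cφq.add cl).intervalIntegrable _ _
    rw [intervalIntegral.integral_sub (cgq.intervalIntegrable _ _) i1, intervalIntegral.integral_add
      (cφq.intervalIntegrable _ _) (cl.intervalIntegrable _ _),
      intervalIntegral.integral_const_mul] at pos
    have e1 : ∫ t in (0 : ℝ)..1, h t * (green w t - φ t) =
        (∫ t in (0 : ℝ)..1, h t * green w t) - ∫ t in (0 : ℝ)..1, φ t ^ q := by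
      simp only [mul_sub, hφq]
      exact intervalIntegral.integral_sub ((ch.mul cg).intervalIntegrable _ _)
        (cφq.intervalIntegrable _ _)
    rw [e1] at pos
    have := hmax w adm
    nlinarith
  refine ⟨φ, c, cφ, φ0, hcpos, ?_, fun t ht => (heq t ht).symm, hwp⟩
  obtain ⟨t, ht, hpos⟩ := exists_pos_of_integral_pos Jpos
  refine ⟨t, ht, (φ0 t).lt_of_ne fun e => ?_⟩
  rw [← e, Real.zero_rpow (by linarith)] at hpos
  exact lt_irrefl _ hpos

end Existence

/-! ### Odd 2-periodic extension. -/

section OddExtension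

/-- The odd 2-periodic function with the values of `f` on `[0,1)`. -/
def oddExt (f : ℝ → ℝ) (t : ℝ) : ℝ :=
  haveI : Fact ((0 : ℝ) < 2) := ⟨two_pos⟩
  AddCircle.liftIco 2 (-1) (fun s => if 0 ≤ s then f s else -f (-s)) (t : AddCircle (2 : ℝ))

variable {f : ℝ → ℝ}

theorem oddExt_of_mem {t : ℝ} (ht : t ∈ Ico (-1 : ℝ) 1) :
    oddExt f t = if 0 ≤ t then f t else -f (-t) := by
  have : Fact ((0 : ℝ) < 2) := ⟨two_pos⟩
  have h : t ∈ Ico (-1 : ℝ) (-1 + 2) := by norm_num; exact ht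
  exact AddCircle.liftIco_coe_apply h

theorem periodic_oddExt (f : ℝ → ℝ) : Function.Periodic (oddExt f) 2 := by
  intro t
  simp [oddExt]

theorem isOddPeriodicExtension_oddExt (h0 : f 0 = 0) (h1 : f 1 = 0) :
    IsOddPeriodicExtension f (oddExt f) := by
  have hm1 : oddExt f (-1) = 0 := by
    rw [oddExt_of_mem (by norm_num), if_neg (by norm_num), neg_neg, h1, neg_zero]
  have hp1 : oddExt f 1 = 0 := by
    rw [← hm1, ← periodic_oddExt f (-1)]; norm_num
  refine ⟨periodic_oddExt f, ?_, ?_⟩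
  · have key : ∀ s ∈ Ico (-1 : ℝ) 1, oddExt f (-s) = -oddExt f s := by
      intro s hs
      rcases eq_or_ne s (-1) with rfl | hne
      · rw [neg_neg, hp1, hm1, neg_zero]
      · have hs1 : -1 < s := hs.1.lt_of_ne' hne
        rw [oddExt_of_mem hs, oddExt_of_mem ⟨by linarith [hs.2], by linarith⟩]
        rcases lt_trichotomy s 0 with h | rfl | h
        · rw [if_pos (by linarith), if_neg (by linarith), neg_neg]
        · simp [h0]
        · rw [if_neg (by linarith), if_pos h.le, neg_neg]
    intro t
    have hper : Function.Periodic (fun t => oddExt f (-t) + oddExt f t) 2 := by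
      intro t
      have e : oddExt f (-(t + 2)) = oddExt f (-t) := by
        rw [← periodic_oddExt f (-(t + 2))]; congr 1; ring
      simp only [e, periodic_oddExt f t]
    obtain ⟨s, hs, he⟩ := hper.exists_mem_Ico two_pos t (-1)
    have hs' : s ∈ Ico (-1 : ℝ) 1 := by norm_num at hs; exact hs
    rw [key s hs'] at he
    linarith
  · intro t ht
    rcases ht.2.eq_or_lt with rfl | hlt
    · rw [hp1, h1]
    · rw [oddExt_of_mem ⟨by linarith [ht.1], hlt⟩, if_pos ht.1]

theorem continuous_oddExt (hf : ContinuousOn f (Icc 0 1)) (h0 : f 0 = 0) (h1 : f 1 = 0) :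
    Continuous (oddExt f) := by
  have : Fact ((0 : ℝ) < 2) := ⟨two_pos⟩
  have hc : Continuous (AddCircle.liftIco (2 : ℝ) (-1) (fun s => if 0 ≤ s then f s else -f (-s))) := by
    refine AddCircle.liftIco_continuous ?_ ?_
    · norm_num [h1]
    · refine ContinuousOn.if ?_ ?_ ?_
      · rintro a ⟨_, ha⟩
        have : frontier {a : ℝ | 0 ≤ a} = {0} := frontier_Ici
        rw [this, mem_singleton_iff] at ha
        rw [ha]; simp [h0]
      · have : closure {a : ℝ | 0 ≤ a} = Ici 0 := closure_Ici 0
        rw [this]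
        refine hf.mono ?_
        rintro x ⟨hx, hx0⟩
        exact ⟨hx0, by linarith [hx.2]⟩
      · have : closure {a : ℝ | ¬ 0 ≤ a} = Iic 0 := by
          simp only [not_le]; exact closure_Iio 0
        rw [this]
        refine (hf.comp continuous_neg.continuousOn ?_).neg
        rintro x ⟨hx, hx0⟩
        have : x ≤ 0 := hx0
        exact ⟨by linarith, by linarith [hx.1]⟩
  exact hc.comp (AddCircle.continuous_mk' 2)

theorem IsOddPeriodicExtension.unique {F G : ℝ → ℝ} (hF : IsOddPeriodicExtension f F)
    (hG : IsOddPeriodicExtension f G) : F = G := by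
  funext t
  have hper : Function.Periodic (fun t => F t - G t) 2 := hF.1.sub hG.1
  obtain ⟨s, hs, he⟩ := hper.exists_mem_Ico two_pos t (-1)
  have hs' : s ∈ Ico (-1 : ℝ) 1 := by norm_num at hs; exact hs
  rcases le_total 0 s with h | h
  · rw [hF.2.2 ⟨h, hs'.2.le⟩, hG.2.2 ⟨h, hs'.2.le⟩] at he
    linarith
  · have e1 := hF.2.2 (x := -s) ⟨by linarith, by linarith [hs'.1]⟩
    have e2 := hG.2.2 (x := -s) ⟨by linarith, by linarith [hs'.1]⟩
    rw [hF.2.1 s] at e1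
    rw [hG.2.1 s] at e2
    linarith

end OddExtension

/-! ### Symmetries preserved by the Green operator. -/

section GreenSymmetry

variable {h k : ℝ → ℝ}

theorem primitive_congr (e : EqOn h k (Icc 0 1)) : EqOn (primitive h) (primitive k) (Icc 0 1) := by
  intro t ht
  refine intervalIntegral.integral_congr fun s hs => e ?_
  rw [uIcc_of_le ht.1] at hs
  exact ⟨hs.1, hs.2.trans ht.2⟩

theorem green_congr (e : EqOn h k (Icc 0 1)) : EqOn (green h) (green k) (Icc 0 1) := by
  intro t ht
  have e2 := primitive_congr (primitive_congr e)
  simp only [green, e2 ht, e2 (right_mem_Icc.2 zero_le_one)]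

/-- Oddness of `h` about `a` makes `greenDeriv h` even about `a`, so `green h t + green h (2 * a -
t)` is constant, equal to `2 * green h a = 0`. The cases `a = 0` and `a = 1` give oddness and
periodicity. -/
theorem green_reflect (hh : Continuous h) {a : ℝ} (ha : ∀ t, h (2 * a - t) = -h t)
    (h0 : green h a = 0) (t : ℝ) : green h (2 * a - t) = -green h t := by
  have hr : ∀ t, HasDerivAt (fun t : ℝ => 2 * a - t) (-1) t := fun t =>
    (hasDerivAt_id t).const_sub (2 * a)
  have aa : 2 * a - a = a := by ring
  have d1 : ∀ t, HasDerivAt (fun t => greenDeriv h t - greenDeriv h (2 * a - t)) 0 t := by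
    intro t
    have := (hasDerivAt_greenDeriv hh t).sub
      ((hasDerivAt_greenDeriv hh (2 * a - t)).comp t (hr t))
    exact this.congr_deriv (by rw [ha]; ring)
  have c1 : ∀ t, greenDeriv h t - greenDeriv h (2 * a - t) = 0 := by
    intro t
    have := is_const_of_deriv_eq_zero (fun t => (d1 t).differentiableAt)
      (fun t => (d1 t).deriv) t a
    rw [this, aa, sub_self]
  have d2 : ∀ t, HasDerivAt (fun t => green h t + green h (2 * a - t)) 0 t := by
    intro t
    have := (hasDerivAt_green hh t).add ((hasDerivAt_green hh (2 * a - t)).comp t (hr t))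
    exact this.congr_deriv (by linarith [c1 t])
  have := is_const_of_deriv_eq_zero (fun t => (d2 t).differentiableAt)
    (fun t => (d2 t).deriv) t a
  rw [aa, h0] at this
  linarith

theorem odd_green (hh : Continuous h) (ho : Function.Odd h) : Function.Odd (green h) := by
  intro t
  have := green_reflect hh (a := 0) (fun t => by simpa using ho t) (green_zero h) t
  simpa using this

theorem periodic_green (hh : Continuous h) (ho : Function.Odd h) (hp : Function.Periodic h 2) :
    Function.Periodic (green h) 2 := by
  intro t
  have h2 := green_reflect hh (a := 1) (fun t => by
    rw [← ho t, ← hp (-t)]; congr 1; ring) (green_one h) (-t)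
  rw [odd_green hh ho t, neg_neg] at h2
  rw [← h2]; congr 1; ring

end GreenSymmetry

/-! ### The fundamental solution. -/

/-- A global odd 2-periodic solution which is positive on `(0,1)`, with normalized second
derivative. -/
structure IsFundamental (p q r l : ℝ) (U U₁ V V₁ : ℝ → ℝ) : Prop where
  sol : IsSolOn r q l univ U U₁ V V₁
  pos : 0 < l
  odd_fst : Function.Odd U
  odd_snd : Function.Odd V
  periodic_fst : Function.Periodic U 2
  periodic_snd : Function.Periodic V 2
  fst_pos : ∀ t ∈ Ioo (0 : ℝ) 1, 0 < U t
  snd_neg : ∀ t ∈ Ioo (0 : ℝ) 1, V t < 0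
  norm_eq : ∫ t in (0 : ℝ)..1, |signedPow r (V t)| ^ p = 1

/-- The Green operator is applied on the whole line to the extended data, so the equations hold at
the integers without gluing. The sign of `V` is negative because `green` inverts `-f''`. -/
theorem exists_isFundamental {p q r : ℝ} (hp : 1 < p) (hq : 1 < q) (hpr : r.HolderConjugate p) :
    ∃ l U U₁ V V₁, IsFundamental p q r l U U₁ V V₁ := by
  obtain ⟨φ, c, cφ, φ0, hc, ⟨x, hx, hφx⟩, hfix, hnorm⟩ := exists_green_fixedPoint hp hq hpr
  have hr := hpr.lt
  have hφ0 : φ 0 = 0 := by rw [hfix 0 (by simp), green_zero]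
  have hφ1 : φ 1 = 0 := by rw [hfix 1 (by simp), green_one]
  set h : ℝ → ℝ := fun x => φ x ^ (q - 1) with hh
  have ch : Continuous h := cφ.rpow_const (fun _ => Or.inr (by linarith))
  have h0 : ∀ t ∈ Icc (0 : ℝ) 1, 0 ≤ h t := fun t _ => Real.rpow_nonneg (φ0 t) _
  have v0 : ∀ t ∈ Icc (0 : ℝ) 1, 0 ≤ green h t := fun t ht => green_nonneg ch h0 ht
  set w : ℝ → ℝ := fun s => c * green h s ^ (r - 1) with hw
  have cw : Continuous w :=
    continuous_const.mul ((continuous_green ch).rpow_const (fun _ => Or.inr (by linarith)))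
  have w0 : ∀ t ∈ Icc (0 : ℝ) 1, 0 ≤ w t := fun t ht =>
    mul_nonneg hc.le (Real.rpow_nonneg (v0 t ht) _)
  have upos : ∀ t ∈ Ioo (0 : ℝ) 1, 0 < φ t := by
    intro t ht
    rw [hfix t (Ioo_subset_Icc_self ht)]
    exact green_pos cw w0 hx (by rw [← hfix x hx]; exact hφx) ht
  -- An interior zero of the concave function `green h` would make it vanish identically, then `w`,
  -- then `φ`.
  have vpos : ∀ t ∈ Ioo (0 : ℝ) 1, 0 < green h t := by
    by_contra! hcon
    obtain ⟨t, ht, hle⟩ := hcon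
    have vz : ∀ s ∈ Icc (0 : ℝ) 1, green h s = 0 := by
      intro s hs
      by_contra hne
      exact absurd (green_pos ch h0 hs ((v0 s hs).lt_of_ne' hne) ht) (not_lt.2 hle)
    have wz : EqOn w 0 (Icc 0 1) := by
      intro s hs
      simp only [hw, vz s hs, Real.zero_rpow (by linarith : r - 1 ≠ 0), mul_zero, Pi.zero_apply]
    have : green (0 : ℝ → ℝ) x = 0 := by simp [green, primitive]
    rw [hfix x hx, green_congr wz hx, this] at hφx
    exact lt_irrefl _ hφx
  set Φ := oddExt φ with hΦ
  have extΦ : IsOddPeriodicExtension φ Φ := isOddPeriodicExtension_oddExt hφ0 hφ1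
  have cΦ : Continuous Φ := continuous_oddExt cφ.continuousOn hφ0 hφ1
  set H : ℝ → ℝ := fun t => signedPow q (Φ t) with hH
  have cH : Continuous H := (continuous_signedPow hq).comp cΦ
  have oH : Function.Odd H := fun t => by simp only [hH, extΦ.2.1 t, signedPow_neg]
  have pH : Function.Periodic H 2 := fun t => by simp only [hH, extΦ.1 t]
  have eH : EqOn H h (Icc 0 1) := fun t ht => by
    simp only [hH, hh, extΦ.2.2 ht, signedPow_of_nonneg hq (φ0 t)]
  have eY := green_congr eH
  set W : ℝ → ℝ := fun t => c * signedPow r (green H t) with hW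
  have cW : Continuous W :=
    continuous_const.mul ((continuous_signedPow hr).comp (continuous_green cH))
  have oW : Function.Odd W := fun t => by
    simp only [hW, odd_green cH oH t, signedPow_neg, mul_neg]
  have pW : Function.Periodic W 2 := fun t => by simp only [hW, periodic_green cH oH pH t]
  have eW : EqOn W w (Icc 0 1) := fun t ht => by
    simp only [hW, hw, eY ht, signedPow_of_nonneg hr (v0 t ht)]
  have eU : EqOn (green W) φ (Icc 0 1) := fun t ht => by rw [green_congr eW ht, hfix t ht]
  have hU : green W = Φ :=
    IsOddPeriodicExtension.unique ⟨periodic_green cW oW pW, odd_green cW oW, eU⟩ extΦ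
  -- The factor `c ^ (p - 1)` moves the constant from the first equation to the second: its
  -- `(r-1)`-th power is `c`, and it becomes the spectral number `l`.
  have hK : 0 < c ^ (p - 1) := Real.rpow_pos_of_pos hc _
  have hKc : (c ^ (p - 1)) ^ (r - 1) = c := by
    rw [← Real.rpow_mul hc.le]
    have : (p - 1) * (r - 1) = 1 := by
      have := hpr.sub_one_mul_conj
      linarith
    rw [this, Real.rpow_one]
  have hWV : ∀ t, signedPow r (-(c ^ (p - 1) * green H t)) = -W t := by
    intro t
    rw [signedPow_neg, signedPow_mul hK, hKc]
  refine ⟨c ^ (p - 1), green W, greenDeriv W, fun t => -(c ^ (p - 1) * green H t),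
    fun t => -(c ^ (p - 1) * greenDeriv H t), ⟨?_, ?_, ?_, ?_⟩, hK, odd_green cW oW, ?_,
    periodic_green cW oW pW, ?_, ?_, ?_, ?_⟩
  · exact fun t _ => (hasDerivAt_green cW t).hasDerivWithinAt
  · intro t _
    rw [hWV]
    exact (hasDerivAt_greenDeriv cW t).hasDerivWithinAt
  · intro t _
    have := ((hasDerivAt_green cH t).const_mul (c ^ (p - 1))).neg
    exact this.hasDerivWithinAt
  · intro t _
    have := ((hasDerivAt_greenDeriv cH t).const_mul (c ^ (p - 1))).neg
    refine (this.congr_deriv ?_).hasDerivWithinAt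
    rw [hU]; ring
  · intro t; simp only [odd_green cH oH t]; ring
  · intro t; simp only [periodic_green cH oH pH t]
  · intro t ht
    rw [eU (Ioo_subset_Icc_self ht)]
    exact upos t ht
  · intro t ht
    rw [eY (Ioo_subset_Icc_self ht)]
    exact neg_neg_of_pos (mul_pos hK (vpos t ht))
  · refine Eq.trans (intervalIntegral.integral_congr fun t ht => ?_) hnorm
    rw [uIcc_of_le zero_le_one] at ht
    simp only [hWV, abs_neg]
    rw [eW ht, abs_of_nonneg (w0 t ht)]

namespace IsFundamental

variable {p q r l : ℝ} {U U₁ V V₁ : ℝ → ℝ}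

theorem apply_int (H : IsFundamental p q r l U U₁ V V₁) (k : ℤ) : U k = 0 ∧ V k = 0 := by
  have key : ∀ f : ℝ → ℝ, Function.Odd f → Function.Periodic f 2 → f k = 0 := by
    intro f ho hp
    have h1 : f k = f (-k) := by
      have := hp.int_mul k (-k : ℝ)
      rw [← this]; congr 1; ring
    rw [ho] at h1
    linarith
  exact ⟨key U H.odd_fst H.periodic_fst, key V H.odd_snd H.periodic_snd⟩

theorem sign_cases (H : IsFundamental p q r l U U₁ V V₁) (k : ℤ) :
    (∀ s ∈ Ioo (0 : ℝ) 1, 0 < U (k + s) ∧ V (k + s) < 0) ∨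
      (∀ s ∈ Ioo (0 : ℝ) 1, U (k + s) < 0 ∧ 0 < V (k + s)) := by
  rcases Int.even_or_odd' k with ⟨m, rfl | rfl⟩
  · left
    intro s hs
    have e : ∀ f : ℝ → ℝ, Function.Periodic f 2 → f ((2 * m : ℤ) + s) = f s := by
      intro f hf
      rw [← hf.int_mul m s]; congr 1; push_cast; ring
    rw [e U H.periodic_fst, e V H.periodic_snd]
    exact ⟨H.fst_pos s hs, H.snd_neg s hs⟩
  · right
    intro s hs
    have e : ∀ f : ℝ → ℝ, Function.Odd f → Function.Periodic f 2 →
        f ((2 * m + 1 : ℤ) + s) = -f (1 - s) := by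
      intro f ho hf
      rw [← ho, ← hf.int_mul (m + 1) (-(1 - s))]; congr 1; push_cast; ring
    rw [e U H.odd_fst H.periodic_fst, e V H.odd_snd H.periodic_snd]
    have hs' : 1 - s ∈ Ioo (0 : ℝ) 1 := ⟨by linarith [hs.2], by linarith [hs.1]⟩
    exact ⟨neg_neg_of_pos (H.fst_pos _ hs'), neg_pos.2 (H.snd_neg _ hs')⟩

/-- The sign alternative behind the rigidity argument: `U` and `V` vanish together or have strictly
opposite signs. -/
theorem int_or_sign (H : IsFundamental p q r l U U₁ V V₁) (t : ℝ) :
    (∃ k : ℤ, t = k) ∨ (0 < U t ∧ V t < 0) ∨ (U t < 0 ∧ 0 < V t) := by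
  rcases eq_or_ne (Int.fract t) 0 with h | h
  · exact Or.inl ⟨⌊t⌋, by rw [← Int.floor_add_fract t, h]; simp⟩
  · have hs : Int.fract t ∈ Ioo (0 : ℝ) 1 :=
      ⟨(Int.fract_nonneg t).lt_of_ne' h, Int.fract_lt_one t⟩
    rcases H.sign_cases ⌊t⌋ with h1 | h1
    · have := h1 _ hs
      rw [Int.floor_add_fract] at this
      exact Or.inr (Or.inl this)
    · have := h1 _ hs
      rw [Int.floor_add_fract] at this
      exact Or.inr (Or.inr this)

theorem fst_eq_zero (H : IsFundamental p q r l U U₁ V V₁) {t : ℝ} :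
    U t = 0 ↔ ∃ k : ℤ, t = k := by
  refine ⟨fun h => ?_, ?_⟩
  · rcases H.int_or_sign t with h1 | h1 | h1
    · exact h1
    · exact absurd h h1.1.ne'
    · exact absurd h h1.1.ne
  · rintro ⟨k, rfl⟩
    exact (H.apply_int k).1

/-- To the right of an integer, `U` and `V` are each concave where positive and convex where
negative. With zero slope at the integer, the tangent bound would contradict the sign at `k + 1/2`.
-/
theorem deriv_int_ne_zero (hr : 1 < r) (hq : 1 < q) (H : IsFundamental p q r l U U₁ V V₁)
    (k : ℤ) : U₁ k ≠ 0 ∧ V₁ k ≠ 0 := by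
  have shift : ∀ {f : ℝ → ℝ} {d t : ℝ}, HasDerivWithinAt f d univ (k + t) →
      HasDerivWithinAt (fun s => f (k + s)) d (Icc 0 (1 / 2)) t := by
    intro f d t hf
    exact ((hasDerivWithinAt_univ.1 hf).comp_const_add (k : ℝ) t).hasDerivWithinAt
  have s1 : ∀ t, HasDerivWithinAt (fun s => U (k + s)) (U₁ (k + t)) (Icc 0 (1 / 2)) t :=
    fun t => shift (H.sol.fst _ (mem_univ _))
  have s2 : ∀ t, HasDerivWithinAt (fun s => U₁ (k + s)) (signedPow r (V (k + t)))
      (Icc 0 (1 / 2)) t := fun t => shift (H.sol.fst_deriv _ (mem_univ _))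
  have s3 : ∀ t, HasDerivWithinAt (fun s => V (k + s)) (V₁ (k + t)) (Icc 0 (1 / 2)) t :=
    fun t => shift (H.sol.snd _ (mem_univ _))
  have s4 : ∀ t, HasDerivWithinAt (fun s => V₁ (k + s)) (l * signedPow q (U (k + t)))
      (Icc 0 (1 / 2)) t := fun t => shift (H.sol.snd_deriv _ (mem_univ _))
  have m1 : (1 / 2 : ℝ) ∈ Icc (0 : ℝ) (1 / 2) := by norm_num
  have m2 : (1 / 2 : ℝ) ∈ Ioo (0 : ℝ) 1 := by norm_num
  have m3 : Ioo (0 : ℝ) (1 / 2) ⊆ Ioo 0 1 := Ioo_subset_Ioo_right (by norm_num)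
  obtain ⟨z1, z2⟩ := H.apply_int k
  have sgn : ∀ {ρ x : ℝ}, 1 < ρ → x ≤ 0 → signedPow ρ x ≤ 0 := fun hρ hx => by
    have := (signedPow_strictMono hρ).monotone hx
    rwa [signedPow_zero] at this
  rcases H.sign_cases k with h | h
  · have t1 := tangent_le_of_second_deriv_nonneg (fun t _ => (s1 t).neg) (fun t _ => (s2 t).neg)
      (fun t ht => neg_nonneg.2 (sgn hr (h t (m3 ht)).2.le)) m1
    have t2 := tangent_le_of_second_deriv_nonneg (fun t _ => s3 t) (fun t _ => s4 t)
      (fun t ht => mul_nonneg H.pos.le (signedPow_pos hq (h t (m3 ht)).1).le) m1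
    simp only [Pi.neg_apply, add_zero, z1, z2] at t1 t2
    constructor
    · intro e
      rw [e] at t1
      linarith [(h _ m2).1]
    · intro e
      rw [e] at t2
      linarith [(h _ m2).2]
  · have t1 := tangent_le_of_second_deriv_nonneg (fun t _ => s1 t) (fun t _ => s2 t)
      (fun t ht => (signedPow_pos hr (h t (m3 ht)).2).le) m1
    have t2 := tangent_le_of_second_deriv_nonneg (fun t _ => (s3 t).neg) (fun t _ => (s4 t).neg)
      (fun t ht => neg_nonneg.2 (mul_nonpos_of_nonneg_of_nonpos H.pos.le
        (sgn hq (h t (m3 ht)).1.le))) m1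
    simp only [Pi.neg_apply, add_zero, z1, z2] at t1 t2
    constructor
    · intro e
      rw [e] at t1
      linarith [(h _ m2).1]
    · intro e
      rw [e] at t2
      linarith [(h _ m2).2]

theorem nondegenerate (hr : 1 < r) (hq : 1 < q) (H : IsFundamental p q r l U U₁ V V₁) (t : ℝ) :
    (U t ≠ 0 ∨ U₁ t ≠ 0) ∧ (V t ≠ 0 ∨ V₁ t ≠ 0) := by
  rcases H.int_or_sign t with ⟨k, rfl⟩ | h | h
  · exact ⟨Or.inr (H.deriv_int_ne_zero hr hq k).1, Or.inr (H.deriv_int_ne_zero hr hq k).2⟩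
  · exact ⟨Or.inl h.1.ne', Or.inl h.2.ne⟩
  · exact ⟨Or.inl h.1.ne, Or.inl h.2.ne'⟩

theorem deriv_zero_pos (hr : 1 < r) (hq : 1 < q) (H : IsFundamental p q r l U U₁ V V₁) :
    0 < U₁ 0 := by
  have h1 : U₁ 0 ≠ 0 := by simpa using (H.deriv_int_ne_zero hr hq 0).1
  refine lt_of_le_of_ne ?_ h1.symm
  have h2 := (hasDerivWithinAt_univ.1 (H.sol.fst 0 (mem_univ _))).hasDerivWithinAt (s := Ioi 0)
  have z : U 0 = 0 := by simpa using (H.apply_int 0).1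
  rw [hasDerivWithinAt_iff_tendsto_slope' (by simp)] at h2
  refine ge_of_tendsto h2 ?_
  filter_upwards [Ioo_mem_nhdsGT (zero_lt_one' ℝ)] with t ht
  rw [slope_def_field, z, sub_zero, sub_zero]
  exact div_nonneg (H.fst_pos t ht).le ht.1.le

end IsFundamental

/-! ### Translation between eigenpairs and the system; scaling. -/

section SecondDerivative

variable {T : ℝ} {f f₁ f₂ g : ℝ → ℝ}

theorem hasDerivWithinAt_of_contDiffOn_two (hT : 0 < T) (hf : ContDiffOn ℝ 2 f (Icc 0 T)) :
    (∀ t ∈ Icc 0 T, HasDerivWithinAt f (derivWithin f (Icc 0 T) t) (Icc 0 T) t) ∧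
    ∀ t ∈ Icc 0 T,
      HasDerivWithinAt (derivWithin f (Icc 0 T)) (secondDeriv T f t) (Icc 0 T) t := by
  have hu := uniqueDiffOn_Icc hT
  refine ⟨fun t ht => (hf.differentiableOn (by norm_num) t ht).hasDerivWithinAt, fun t ht => ?_⟩
  have h1 := hf.differentiableOn_iteratedDerivWithin (m := 1) (by norm_num) hu
  rw [iteratedDerivWithin_one] at h1
  have h2 := (h1 t ht).hasDerivWithinAt
  rw [secondDeriv, iteratedDerivWithin_succ, iteratedDerivWithin_one]
  exact h2

theorem derivWithin_eqOn (hT : 0 < T)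
    (h1 : ∀ t ∈ Icc 0 T, HasDerivWithinAt f (f₁ t) (Icc 0 T) t) :
    EqOn (derivWithin f (Icc 0 T)) f₁ (Icc 0 T) :=
  fun t ht => (h1 t ht).derivWithin (uniqueDiffOn_Icc hT t ht)

theorem secondDeriv_eqOn (hT : 0 < T)
    (h1 : ∀ t ∈ Icc 0 T, HasDerivWithinAt f (f₁ t) (Icc 0 T) t)
    (h2 : ∀ t ∈ Icc 0 T, HasDerivWithinAt f₁ (f₂ t) (Icc 0 T) t) :
    EqOn (secondDeriv T f) f₂ (Icc 0 T) := by
  intro t ht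
  rw [secondDeriv, iteratedDerivWithin_succ, iteratedDerivWithin_one,
    derivWithin_congr (derivWithin_eqOn hT h1) (derivWithin_eqOn hT h1 ht)]
  exact derivWithin_eqOn hT h2 ht

theorem contDiffOn_two (hT : 0 < T)
    (h1 : ∀ t ∈ Icc 0 T, HasDerivWithinAt f (f₁ t) (Icc 0 T) t)
    (h2 : ∀ t ∈ Icc 0 T, HasDerivWithinAt f₁ (f₂ t) (Icc 0 T) t)
    (hc : ContinuousOn f₂ (Icc 0 T)) : ContDiffOn ℝ 2 f (Icc 0 T) := by
  have hu := uniqueDiffOn_Icc hT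
  have e : (2 : WithTop ℕ∞) = 1 + 1 := by norm_num
  have e' : (1 : WithTop ℕ∞) = 0 + 1 := by norm_num
  rw [e, contDiffOn_succ_iff_derivWithin hu]
  refine ⟨fun t ht => (h1 t ht).differentiableWithinAt, by simp, ?_⟩
  refine ContDiffOn.congr ?_ (derivWithin_eqOn hT h1)
  rw [e', contDiffOn_succ_iff_derivWithin hu]
  refine ⟨fun t ht => (h2 t ht).differentiableWithinAt, by simp, ?_⟩
  exact (contDiffOn_zero.2 hc).congr (derivWithin_eqOn hT h2)

theorem secondDeriv_congr (h : EqOn f g (Icc 0 T)) :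
    EqOn (secondDeriv T f) (secondDeriv T g) (Icc 0 T) := iteratedDerivWithin_congr h

theorem eLpNorm_eq_one_iff {p : ℝ} (hp : 1 < p) (hT : 0 < T) (hg : ContinuousOn g (Icc 0 T)) :
    eLpNorm g (ENNReal.ofReal p) (volume.restrict (Icc 0 T)) = 1 ↔
      ∫ t in (0 : ℝ)..T, |g t| ^ p = 1 := by
  have hp0 : 0 < p := by linarith
  have hmem : MemLp g (ENNReal.ofReal p) (volume.restrict (Icc 0 T)) := by
    obtain ⟨C, hC⟩ := isCompact_Icc.exists_bound_of_continuousOn hg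
    refine MemLp.of_bound (hg.aestronglyMeasurable measurableSet_Icc) C ?_
    exact (ae_restrict_iff' measurableSet_Icc).2 (Filter.Eventually.of_forall hC)
  rw [hmem.eLpNorm_eq_integral_rpow_norm (by simpa using hp0) ENNReal.ofReal_ne_top,
    ENNReal.toReal_ofReal hp0.le, ENNReal.ofReal_eq_one, integral_Icc_eq_integral_Ioc,
    ← intervalIntegral.integral_of_le hT.le]
  simp only [Real.norm_eq_abs]
  have h0 : 0 ≤ ∫ t in (0 : ℝ)..T, |g t| ^ p :=
    intervalIntegral.integral_nonneg hT.le fun t _ => Real.rpow_nonneg (abs_nonneg _) _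
  constructor
  · intro h
    rwa [Real.rpow_inv_eq h0 zero_le_one hp0.ne', Real.one_rpow] at h
  · intro h
    rw [h, Real.one_rpow]

end SecondDerivative

section Eigenpairs

variable {p q r T μ : ℝ} {f f₁ v v₁ g : ℝ → ℝ}

/-- An eigenpair is a solution of the first-order system in the variables `f`, `[f'']^{p-1}`. -/
theorem IsEigenpair.isSolOn (hp : 1 < p) (hr : 1 < r) (hpr : (p - 1) * (r - 1) = 1) (hT : 0 < T)
    (h : IsEigenpair p q T f μ) :
    ∃ v v₁, IsSolOn r q μ (Icc 0 T) f (derivWithin f (Icc 0 T)) v v₁ ∧ v 0 = 0 ∧ v T = 0 ∧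
      ∀ t, secondDeriv T f t = signedPow r (v t) := by
  have hr' : ∀ t, secondDeriv T f t = signedPow r (signedPow p (secondDeriv T f t)) := fun t =>
    (signedPow_signedPow hp hr hpr _).symm
  obtain ⟨a1, a2⟩ := hasDerivWithinAt_of_contDiffOn_two hT h.contDiffOn
  obtain ⟨b1, b2⟩ := hasDerivWithinAt_of_contDiffOn_two hT h.contDiffOn_signedPow
  refine ⟨fun t => signedPow p (secondDeriv T f t),
    derivWithin (fun t => signedPow p (secondDeriv T f t)) (Icc 0 T), ⟨a1, ?_, b1, ?_⟩, ?_, ?_, hr'⟩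
  · intro t ht
    rw [← hr']
    exact a2 t ht
  · intro t ht
    rw [← h.equation t ht]
    exact b2 t ht
  · simp only [h.secondDeriv_left, signedPow_zero]
  · simp only [h.secondDeriv_right, signedPow_zero]

theorem IsSolOn.isEigenpair (hp : 1 < p) (hq : 1 < q) (hr : 1 < r) (hpr : (p - 1) * (r - 1) = 1)
    (hT : 0 < T) (h : IsSolOn r q μ (Icc 0 T) f f₁ v v₁) (hμ : 0 < μ) (f0 : f 0 = 0)
    (fT : f T = 0) (v0 : v 0 = 0) (vT : v T = 0) (hne : ∃ t ∈ Icc 0 T, f t ≠ 0) :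
    IsEigenpair p q T f μ := by
  have hrp : (r - 1) * (p - 1) = 1 := by linarith
  have cf : ContinuousOn f (Icc 0 T) := fun t ht => (h.fst t ht).continuousWithinAt
  have cv : ContinuousOn v (Icc 0 T) := fun t ht => (h.snd t ht).continuousWithinAt
  have e1 := secondDeriv_eqOn hT h.fst h.fst_deriv
  have e2 : EqOn (fun t => signedPow p (secondDeriv T f t)) v (Icc 0 T) := fun t ht => by
    simp only [e1 ht, signedPow_signedPow hr hp hrp]
  have m0 : (0 : ℝ) ∈ Icc 0 T := ⟨le_rfl, hT.le⟩
  have mT : T ∈ Icc 0 T := ⟨hT.le, le_rfl⟩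
  refine ⟨contDiffOn_two hT h.fst h.fst_deriv ((continuous_signedPow hr).comp_continuousOn cv),
    (contDiffOn_two hT h.snd h.snd_deriv
      (continuousOn_const.mul ((continuous_signedPow hq).comp_continuousOn cf))).congr e2, ?_,
    f0, fT, ?_, ?_, hne, hμ⟩
  · intro t ht
    rw [secondDeriv_congr e2 ht]
    exact secondDeriv_eqOn hT h.snd h.snd_deriv ht
  · simp only [e1 m0, v0, signedPow_zero]
  · simp only [e1 mT, vT, signedPow_zero]

theorem IsSpectralCouple.congr (hT : 0 < T) (h : IsSpectralCouple p q T f μ)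
    (e : EqOn g f (Icc 0 T)) : IsSpectralCouple p q T g μ := by
  have m0 : (0 : ℝ) ∈ Icc 0 T := ⟨le_rfl, hT.le⟩
  have mT : T ∈ Icc 0 T := ⟨hT.le, le_rfl⟩
  have e2 := secondDeriv_congr e
  have e3 : EqOn (fun t => signedPow p (secondDeriv T g t))
      (fun t => signedPow p (secondDeriv T f t)) (Icc 0 T) := fun t ht => by simp only [e2 ht]
  obtain ⟨t, ht, hne⟩ := h.isEigenpair.ne_zero
  refine ⟨⟨h.isEigenpair.contDiffOn.congr e, h.isEigenpair.contDiffOn_signedPow.congr e3, ?_, ?_,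
    ?_, ?_, ?_, ⟨t, ht, by rwa [e ht]⟩, h.isEigenpair.pos⟩, ?_, ?_⟩
  · intro t ht
    rw [secondDeriv_congr e3 ht, h.isEigenpair.equation t ht, e ht]
  · rw [e m0, h.isEigenpair.left]
  · rw [e mT, h.isEigenpair.right]
  · rw [e2 m0, h.isEigenpair.secondDeriv_left]
  · rw [e2 mT, h.isEigenpair.secondDeriv_right]
  · rw [← h.norm_eq_one]
    refine eLpNorm_congr_ae ?_
    exact (ae_restrict_iff' measurableSet_Icc).2 (Filter.Eventually.of_forall fun t ht => e2 ht)
  · rw [derivWithin_congr e (e m0)]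
    exact h.deriv_pos

/-- Rescaling of solutions in amplitude and time. -/
theorem IsSolOn.scale {l : ℝ} {U U₁ V V₁ : ℝ → ℝ} (hpr : (p - 1) * (r - 1) = 1)
    (h : IsSolOn r q l univ U U₁ V V₁) {c s : ℝ} (hc : 0 < c) (hs : 0 < s) :
    IsSolOn r q (c ^ (p - q) * s ^ (2 * p) * l) univ
      (fun t => c * U (s * t)) (fun t => c * s * U₁ (s * t))
      (fun t => (c * s ^ 2) ^ (p - 1) * V (s * t))
      (fun t => (c * s ^ 2) ^ (p - 1) * s * V₁ (s * t)) := by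
  have hcs : 0 < c * s ^ 2 := by positivity
  have hd : 0 < (c * s ^ 2) ^ (p - 1) := Real.rpow_pos_of_pos hcs _
  -- Since `u''` is multiplied by `c * s ^ 2`, its signed power `v` is multiplied by the `(p-1)`-th
  -- power, and the conjugate power undoes this.
  have hdr : ((c * s ^ 2) ^ (p - 1)) ^ (r - 1) = c * s ^ 2 := by
    rw [← Real.rpow_mul hcs.le, hpr, Real.rpow_one]
  have key : ∀ {F : ℝ → ℝ} {d t : ℝ} (a : ℝ), HasDerivWithinAt F d univ (s * t) →
      HasDerivWithinAt (fun t => a * F (s * t)) (a * (s * d)) univ t := by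
    intro F d t a hF
    have h1 : HasDerivAt F d (s * t) := hasDerivWithinAt_univ.1 hF
    have h2 : HasDerivAt (fun t : ℝ => s * t) s t := by simpa using (hasDerivAt_id t).const_mul s
    have h3 := (h1.comp t h2).const_mul a
    exact (h3.congr_deriv (by ring)).hasDerivWithinAt
  refine ⟨fun t _ => ?_, fun t _ => ?_, fun t _ => ?_, fun t _ => ?_⟩
  · exact (key c (h.fst (s * t) (mem_univ _))).congr_deriv (by ring)
  · refine (key (c * s) (h.fst_deriv (s * t) (mem_univ _))).congr_deriv ?_
    rw [signedPow_mul hd, hdr]; ring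
  · exact (key _ (h.snd (s * t) (mem_univ _))).congr_deriv (by ring)
  · refine (key _ (h.snd_deriv (s * t) (mem_univ _))).congr_deriv ?_
    rw [signedPow_mul hc]
    have e1 : c ^ (p - 1) = c ^ (p - q) * c ^ (q - 1) := by
      rw [← Real.rpow_add hc]; congr 1; ring
    have e2 : s ^ (2 * p) = (s ^ 2) ^ (p - 1) * (s * s) := by
      have : s * s = (s ^ 2) ^ (1 : ℝ) := by rw [Real.rpow_one]; ring
      rw [this, ← Real.rpow_add (by positivity), sub_add_cancel, Real.rpow_mul hs.le,
        Real.rpow_two]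
    rw [Real.mul_rpow hc.le (by positivity), e1, e2]
    ring

end Eigenpairs

/-! ### The modes exhaust the spectral couples. -/

/-- The rescaled function `T^{2-1/p} k^{-2} U(kt/T)`. -/
def mode (p T : ℝ) (k : ℕ) (U : ℝ → ℝ) (t : ℝ) : ℝ :=
  T ^ (2 - 1 / p) / (k : ℝ) ^ 2 * U (k * t / T)

/-- The corresponding spectral number `k^{2q} T^{q/p-1-2q} l`. -/
def modeNumber (p q T : ℝ) (k : ℕ) (l : ℝ) : ℝ :=
  (k : ℝ) ^ (2 * q) * T ^ (q / p - 1 - 2 * q) * l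

/-- The left side is the scaling law of `IsSolOn.scale` at the amplitude and frequency of the `k`-th
mode. -/
theorem modeNumber_eq {p q T : ℝ} (hp : 1 < p) (hT : 0 < T) {k : ℕ} (hk : 1 ≤ k) (l : ℝ) :
    (T ^ (2 - 1 / p) / (k : ℝ) ^ 2) ^ (p - q) * ((k : ℝ) / T) ^ (2 * p) * l =
      modeNumber p q T k l := by
  have hk0 : (0 : ℝ) < k := by exact_mod_cast hk
  have hp0 : p ≠ 0 := by linarith
  have e1 : ((k : ℝ) ^ 2) ^ (p - q) = (k : ℝ) ^ (2 * (p - q)) := by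
    rw [Real.rpow_mul hk0.le, Real.rpow_two]
  rw [modeNumber, Real.div_rpow (Real.rpow_nonneg hT.le _) (by positivity), e1,
    ← Real.rpow_mul hT.le, Real.div_rpow hk0.le hT.le]
  congr 1
  have e2 : T ^ ((2 - 1 / p) * (p - q)) = T ^ (q / p - 1 - 2 * q) * T ^ (2 * p) := by
    rw [← Real.rpow_add hT]; congr 1; field_simp; ring
  have e3 : (k : ℝ) ^ (2 * p) = (k : ℝ) ^ (2 * q) * (k : ℝ) ^ (2 * (p - q)) := by
    rw [← Real.rpow_add hk0]; congr 1; ring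
  have h1 : T ^ (2 * p) ≠ 0 := (Real.rpow_pos_of_pos hT _).ne'
  have h2 : (k : ℝ) ^ (2 * (p - q)) ≠ 0 := (Real.rpow_pos_of_pos hk0 _).ne'
  rw [e2, e3]
  field_simp

theorem modeNumber_strictMono {p q T l : ℝ} (hq : 1 < q) (hT : 0 < T) (hl : 0 < l) {j k : ℕ} :
    modeNumber p q T j l < modeNumber p q T k l ↔ j < k := by
  have hT' := Real.rpow_pos_of_pos hT (q / p - 1 - 2 * q)
  rw [modeNumber, modeNumber, mul_lt_mul_iff_of_pos_right hl, mul_lt_mul_iff_of_pos_right hT',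
    Real.rpow_lt_rpow_iff (by positivity) (by positivity) (by linarith), Nat.cast_lt]

namespace IsFundamental

variable {p q r l T : ℝ} {U U₁ V V₁ : ℝ → ℝ}

theorem continuous_snd (H : IsFundamental p q r l U U₁ V V₁) : Continuous V :=
  continuous_iff_continuousAt.2 fun t =>
    (hasDerivWithinAt_univ.1 (H.sol.snd t (mem_univ t))).continuousAt

/-- The integrand is even and 2-periodic, so `t ↦ 2 * (k + 1) - t` carries each unit interval onto
its predecessor without changing the integral. -/
theorem integral_nat (hp : 1 < p) (hr : 1 < r) (H : IsFundamental p q r l U U₁ V V₁) (k : ℕ) :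
    ∫ t in (0 : ℝ)..k, |signedPow r (V t)| ^ p = k := by
  set F : ℝ → ℝ := fun t => |signedPow r (V t)| ^ p with hF
  have cF : Continuous F := ((continuous_signedPow hr).comp H.continuous_snd).abs.rpow_const
    (fun _ => Or.inr (by linarith))
  have even : ∀ t, F (-t) = F t := fun t => by
    simp only [hF, H.odd_snd t, signedPow_neg, abs_neg]
  have per : Function.Periodic F 2 := fun t => by simp only [hF, H.periodic_snd t]
  have step : ∀ k : ℕ, ∫ t in (k : ℝ)..(k + 1 : ℕ), F t = 1 := by
    intro k
    induction k with
    | zero => simpa using H.norm_eq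
    | succ k ih =>
      rw [← ih]
      have e1 : ∀ t, F t = F (-(t - (2 * (k + 1) : ℕ))) := fun t => by
        rw [even, ← per.nat_mul (k + 1) (t - (2 * (k + 1) : ℕ))]
        congr 1; push_cast; ring
      calc ∫ t in ((k + 1 : ℕ) : ℝ)..(k + 1 + 1 : ℕ), F t
          = ∫ t in ((k + 1 : ℕ) : ℝ)..(k + 1 + 1 : ℕ), F ((2 * (k + 1) : ℕ) - t) := by
            refine intervalIntegral.integral_congr fun t _ => ?_
            rw [e1 t, neg_sub]
        _ = ∫ t in (k : ℝ)..(k + 1 : ℕ), F t := by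
            rw [intervalIntegral.integral_comp_sub_left]
            congr 1 <;> push_cast <;> ring
  induction k with
  | zero => simp
  | succ k ih =>
    rw [← intervalIntegral.integral_add_adjacent_intervals (cF.intervalIntegrable 0 k)
      (cF.intervalIntegrable _ _), ih, step k]
    push_cast; ring

theorem integral_scale (hp : 1 < p) (hr : 1 < r) (hpr : (p - 1) * (r - 1) = 1)
    (H : IsFundamental p q r l U U₁ V V₁) {c s : ℝ} (hc : 0 < c) (hs : 0 < s) {k : ℕ}
    (hk : s * T = k) :
    ∫ t in (0 : ℝ)..T, |signedPow r ((c * s ^ 2) ^ (p - 1) * V (s * t))| ^ p =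
      (c * s ^ 2) ^ p * T := by
  have hcs : 0 < c * s ^ 2 := by positivity
  have hd : 0 < (c * s ^ 2) ^ (p - 1) := Real.rpow_pos_of_pos hcs _
  have hdr : ((c * s ^ 2) ^ (p - 1)) ^ (r - 1) = c * s ^ 2 := by
    rw [← Real.rpow_mul hcs.le, hpr, Real.rpow_one]
  have e : ∀ t, |signedPow r ((c * s ^ 2) ^ (p - 1) * V (s * t))| ^ p =
      (c * s ^ 2) ^ p * |signedPow r (V (s * t))| ^ p := fun t => by
    rw [signedPow_mul hd, hdr, abs_mul, abs_of_pos hcs, Real.mul_rpow hcs.le (abs_nonneg _)]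
  simp only [e]
  rw [intervalIntegral.integral_const_mul, intervalIntegral.integral_comp_mul_left
    (fun t => |signedPow r (V t)| ^ p) hs.ne', mul_zero, hk, H.integral_nat hp hr k, ← hk,
    smul_eq_mul, inv_mul_cancel_left₀ hs.ne']

theorem isSpectralCouple_mode (hp : 1 < p) (hq : 1 < q) (hr : 1 < r)
    (hpr : (p - 1) * (r - 1) = 1) (H : IsFundamental p q r l U U₁ V V₁) (hT : 0 < T) {k : ℕ}
    (hk : 1 ≤ k) : IsSpectralCouple p q T (mode p T k U) (modeNumber p q T k l) := by
  have hk0 : (0 : ℝ) < k := by exact_mod_cast hk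
  have hp0 : p ≠ 0 := by linarith
  set c : ℝ := T ^ (2 - 1 / p) / (k : ℝ) ^ 2 with hc
  set s : ℝ := k / T with hs
  have hc0 : 0 < c := div_pos (Real.rpow_pos_of_pos hT _) (by positivity)
  have hs0 : 0 < s := div_pos hk0 hT
  have hsT : s * T = k := div_mul_cancel₀ _ hT.ne'
  have sol := (H.sol.scale hpr hc0 hs0).mono (subset_univ (Icc 0 T))
  rw [hc, hs, modeNumber_eq hp hT hk, ← hc, ← hs] at sol
  have emode : mode p T k U = fun t => c * U (s * t) := by
    funext t
    rw [mode, ← hc, hs]; congr 2; ring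
  have hU0 := H.apply_int 0
  have hUk := H.apply_int k
  simp only [Int.cast_zero] at hU0
  simp only [Int.cast_natCast] at hUk
  have m0 : (0 : ℝ) ∈ Icc 0 T := ⟨le_rfl, hT.le⟩
  have hmn : 0 < modeNumber p q T k l :=
    mul_pos (mul_pos (Real.rpow_pos_of_pos hk0 _) (Real.rpow_pos_of_pos hT _)) H.pos
  rw [emode]
  -- The witness `1 / 2 / s` is where the rescaled argument equals `1/2`; it lies in the interval
  -- since `k ≥ 1`.
  refine ⟨sol.isEigenpair hp hq hr hpr hT hmn ?_ ?_ ?_ ?_ ⟨1 / 2 / s, ⟨by positivity, ?_⟩, ?_⟩,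
    ?_, ?_⟩
  · rw [mul_zero, hU0.1, mul_zero]
  · rw [hsT, hUk.1, mul_zero]
  · rw [mul_zero, hU0.2, mul_zero]
  · rw [hsT, hUk.2, mul_zero]
  · rw [div_le_iff₀ hs0, mul_comm, hsT]
    have : (1 : ℝ) ≤ k := by exact_mod_cast hk
    linarith
  · rw [mul_div_cancel₀ _ hs0.ne']
    exact (mul_pos hc0 (H.fst_pos _ (by norm_num))).ne'
  · have e := secondDeriv_eqOn hT sol.fst sol.fst_deriv
    have cV : Continuous fun t => signedPow r ((c * s ^ 2) ^ (p - 1) * V (s * t)) :=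
      (continuous_signedPow hr).comp
        (continuous_const.mul (H.continuous_snd.comp (continuous_const.mul continuous_id)))
    rw [eLpNorm_eq_one_iff hp hT (cV.continuousOn.congr e)]
    -- This identity is the reason for the exponent `2 - 1 / p`: it makes `(c * s ^ 2) ^ p * T`
    -- equal to `1`.
    have : c * s ^ 2 = T ^ (-(1 / p)) := by
      rw [hc, hs, sub_eq_add_neg, Real.rpow_add hT, Real.rpow_two]
      field_simp
    calc ∫ t in (0 : ℝ)..T, |secondDeriv T (fun t => c * U (s * t)) t| ^ p
        = ∫ t in (0 : ℝ)..T, |signedPow r ((c * s ^ 2) ^ (p - 1) * V (s * t))| ^ p := by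
          refine intervalIntegral.integral_congr fun t ht => ?_
          rw [uIcc_of_le hT.le] at ht
          simp only [e ht]
      _ = (c * s ^ 2) ^ p * T := H.integral_scale hp hr hpr hc0 hs0 hsT
      _ = 1 := by
          rw [this, ← Real.rpow_mul hT.le, neg_mul, one_div_mul_cancel hp0, Real.rpow_neg_one,
            inv_mul_cancel₀ hT.ne']
  · simp only [derivWithin_eqOn hT sol.fst m0, mul_zero]
    exact mul_pos (mul_pos hc0 hs0) (H.deriv_zero_pos hr hq)

/-- Every spectral couple is one of the modes. -/
theorem eq_mode (hp : 1 < p) (hq : 1 < q) (hr : 1 < r)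
    (hpr : (p - 1) * (r - 1) = 1) (H : IsFundamental p q r l U U₁ V V₁) (hT : 0 < T)
    {g : ℝ → ℝ} {ν : ℝ} (h : IsSpectralCouple p q T g ν) :
    ∃ k : ℕ, 1 ≤ k ∧ EqOn g (mode p T k U) (Icc 0 T) ∧ ν = modeNumber p q T k l := by
  obtain ⟨v, v₁, sol, v0, vT, hsd⟩ := h.isEigenpair.isSolOn hp hr hpr hT
  have hν := h.isEigenpair.pos
  have hl := H.pos
  have ha := H.deriv_zero_pos hr hq
  have hα := h.deriv_pos
  set α := derivWithin g (Icc 0 T) 0 with hαdef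
  have hp0 : p ≠ 0 := by linarith
  -- Two parameters for two data. Matching the slope forces `c = A / s`; the second condition
  -- becomes `A^(p-q) * s^(p+q) * l = ν`, solvable because `p + q > 0`.
  obtain ⟨c, s, hc, hs, hcs, hcν⟩ : ∃ c s : ℝ, 0 < c ∧ 0 < s ∧ c * s * U₁ 0 = α ∧
      c ^ (p - q) * s ^ (2 * p) * l = ν := by
    set A := α / U₁ 0 with hA
    have hA0 : 0 < A := div_pos hα ha
    have hB : 0 < ν / l / A ^ (p - q) :=
      div_pos (div_pos hν hl) (Real.rpow_pos_of_pos hA0 _)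
    set s := (ν / l / A ^ (p - q)) ^ (1 / (p + q)) with hs
    have hs0 : 0 < s := Real.rpow_pos_of_pos hB _
    refine ⟨A / s, s, div_pos hA0 hs0, hs0, ?_, ?_⟩
    · rw [div_mul_cancel₀ _ hs0.ne', hA, div_mul_cancel₀ _ ha.ne']
    · have e1 : s ^ (2 * p) = s ^ (p - q) * s ^ (p + q) := by
        rw [← Real.rpow_add hs0]; congr 1; ring
      have e2 : s ^ (p + q) = ν / l / A ^ (p - q) := by
        rw [hs, ← Real.rpow_mul hB.le, one_div_mul_cancel (by linarith), Real.rpow_one]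
      have h1 : A ^ (p - q) ≠ 0 := (Real.rpow_pos_of_pos hA0 _).ne'
      have h2 : s ^ (p - q) ≠ 0 := (Real.rpow_pos_of_pos hs0 _).ne'
      rw [Real.div_rpow hA0.le hs0.le, e1, e2]
      field_simp
  have Sol := (H.sol.scale hpr hc hs).mono (subset_univ (Icc 0 T))
  rw [hcν] at Sol
  have hU0 := H.apply_int 0
  simp only [Int.cast_zero] at hU0
  have hd : 0 < (c * s ^ 2) ^ (p - 1) := Real.rpow_pos_of_pos (by positivity) _
  have i1 : g 0 = c * U (s * 0) := by rw [h.isEigenpair.left, mul_zero, hU0.1, mul_zero]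
  have i2 : derivWithin g (Icc 0 T) 0 = c * s * U₁ (s * 0) := by rw [mul_zero, hcs]
  have i3 : v 0 = (c * s ^ 2) ^ (p - 1) * V (s * 0) := by rw [v0, mul_zero, hU0.2, mul_zero]
  -- If the slopes differ, comparison at `T`, where `g` and `v` vanish, gives either `U ≥ 0, V > 0`
  -- or `U ≤ 0, V < 0` at `s * T`, both excluded by `int_or_sign`.
  have i4 : v₁ 0 = (c * s ^ 2) ^ (p - 1) * s * V₁ (s * 0) := by
    rcases lt_trichotomy (v₁ 0) ((c * s ^ 2) ^ (p - 1) * s * V₁ (s * 0)) with hlt | heq | hgt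
    · obtain ⟨c1, c2⟩ := sol.comparison hr hq hν hT Sol i1 i2 i3 hlt
      rw [h.isEigenpair.right] at c1
      rw [vT] at c2
      have d1 := nonneg_of_mul_nonneg_right c1 hc
      have d2 := pos_of_mul_pos_right c2 hd.le
      rcases H.int_or_sign (s * T) with ⟨k, hk⟩ | hk | hk
      · rw [hk, (H.apply_int k).2] at d2
        exact absurd d2 (lt_irrefl _)
      · linarith [hk.2]
      · linarith [hk.1]
    · exact heq
    · obtain ⟨c1, c2⟩ := Sol.comparison hr hq hν hT sol i1.symm i2.symm i3.symm hgt
      rw [h.isEigenpair.right] at c1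
      rw [vT] at c2
      have d1 : U (s * T) ≤ 0 := by
        by_contra! hcon
        exact absurd (mul_pos hc hcon) (not_lt.2 c1)
      have d2 : V (s * T) < 0 := by
        by_contra! hcon
        exact absurd (mul_nonneg hd.le hcon) (not_le.2 c2)
      rcases H.int_or_sign (s * T) with ⟨k, hk⟩ | hk | hk
      · rw [hk, (H.apply_int k).2] at d2
        exact absurd d2 (lt_irrefl _)
      · linarith [hk.1]
      · linarith [hk.2]
  have hcs0 : 0 < c * s := mul_pos hc hs
  have uniq := sol.unique hr hq hν Sol i1 i2 i3 i4
    (fun t => (H.nondegenerate hr hq (s * t)).1.imp (mul_ne_zero hc.ne') (mul_ne_zero hcs0.ne'))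
    (fun t => (H.nondegenerate hr hq (s * t)).2.imp (mul_ne_zero hd.ne')
      (mul_ne_zero (mul_pos hd hs).ne'))
  have mT : T ∈ Icc 0 T := ⟨hT.le, le_rfl⟩
  have hUT : U (s * T) = 0 := by
    have := (uniq T mT).1.1
    rw [h.isEigenpair.right] at this
    exact (mul_eq_zero.1 this.symm).resolve_left hc.ne'
  obtain ⟨k', hk'⟩ := H.fst_eq_zero.1 hUT
  have hk'pos : 0 < k' := by
    have : 0 < s * T := mul_pos hs hT
    rw [hk'] at this
    exact_mod_cast this
  lift k' to ℕ using hk'pos.le with k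
  have hk : s * T = k := by simpa using hk'
  have hk1 : 1 ≤ k := by exact_mod_cast hk'pos
  have hs' : s = k / T := by rw [← hk, mul_div_cancel_right₀ _ hT.ne']
  have cv : ContinuousOn v (Icc 0 T) := fun t ht => (sol.snd t ht).continuousWithinAt
  -- Now that `s * T` is an integer, the norm condition determines the amplitude `c`.
  have hnorm : (c * s ^ 2) ^ p * T = 1 := by
    have h1 := (eLpNorm_eq_one_iff hp hT (((continuous_signedPow hr).comp_continuousOn cv).congr
      (fun t _ => hsd t))).1 h.norm_eq_one
    rw [← h1, ← H.integral_scale hp hr hpr hc hs hk]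
    refine intervalIntegral.integral_congr fun t ht => ?_
    rw [uIcc_of_le hT.le] at ht
    simp only [hsd t, (uniq t ht).2.1]
  have hc' : c = T ^ (2 - 1 / p) / (k : ℝ) ^ 2 := by
    have e1 : (c * s ^ 2) ^ p = (T ^ (-(1 / p))) ^ p := by
      rw [← Real.rpow_mul hT.le, neg_mul, one_div_mul_cancel hp0, Real.rpow_neg_one]
      exact eq_inv_of_mul_eq_one_left hnorm
    have e2 : c * s ^ 2 = T ^ (-(1 / p)) :=
      (Real.rpow_left_inj (by positivity) (Real.rpow_nonneg hT.le _) hp0).1 e1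
    have hk0 : (0 : ℝ) < k := by exact_mod_cast hk1
    rw [sub_eq_add_neg, Real.rpow_add hT, Real.rpow_two, ← e2, hs']
    field_simp
  refine ⟨k, hk1, fun t ht => ?_, ?_⟩
  · rw [(uniq t ht).1.1, mode, ← hc', hs']
    congr 2; ring
  · rw [← modeNumber_eq hp hT hk1, ← hc', ← hs', hcν]

end IsFundamental

/-! ### Counting zeros and spectral numbers. -/

namespace IsFundamental

variable {p q r l T : ℝ} {U U₁ V V₁ f : ℝ → ℝ}

/-- The interior zeros of the `k`-th mode are the points `j * T / k` with `0 < j < k`, which number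
`k - 1`. -/
theorem hasPredZeros_iff (H : IsFundamental p q r l U U₁ V V₁) (hT : 0 < T) {k n : ℕ}
    (hk : 1 ≤ k) (e : EqOn f (mode p T k U) (Icc 0 T)) : HasPredZeros T n f ↔ k = n := by
  have hk0 : (0 : ℝ) < k := by exact_mod_cast hk
  have hc : T ^ (2 - 1 / p) / (k : ℝ) ^ 2 ≠ 0 :=
    (div_pos (Real.rpow_pos_of_pos hT _) (by positivity)).ne'
  have hset : {t ∈ Ioo 0 T | f t = 0} =
      (fun j : ℕ => (j : ℝ) * T / k) '' (Finset.Ioo 0 k : Set ℕ) := by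
    ext t
    simp only [mem_image, Finset.coe_Ioo, mem_Ioo]
    constructor
    · rintro ⟨ht, h0⟩
      rw [e ⟨ht.1.le, ht.2.le⟩, mode, mul_eq_zero, or_iff_right hc, H.fst_eq_zero] at h0
      obtain ⟨j, hj⟩ := h0
      have hj0 : 0 < j := by
        have : 0 < (k : ℝ) * t / T := div_pos (mul_pos hk0 ht.1) hT
        rw [hj] at this
        exact_mod_cast this
      lift j to ℕ using hj0.le
      rw [Int.cast_natCast, div_eq_iff hT.ne'] at hj
      refine ⟨j, ⟨by exact_mod_cast hj0, ?_⟩, ?_⟩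
      · have : (j : ℝ) * T < k * T := by
          rw [← hj]
          exact mul_lt_mul_of_pos_left ht.2 hk0
        exact_mod_cast lt_of_mul_lt_mul_right this hT.le
      · rw [← hj, mul_div_cancel_left₀ _ hk0.ne']
    · rintro ⟨j, ⟨hj0, hjk⟩, rfl⟩
      have h0 : (0 : ℝ) < j := by exact_mod_cast hj0
      have h1 : (j : ℝ) < k := by exact_mod_cast hjk
      have ht : 0 < (j : ℝ) * T / k ∧ (j : ℝ) * T / k < T := by
        refine ⟨by positivity, ?_⟩
        rw [div_lt_iff₀ hk0, mul_comm T]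
        exact mul_lt_mul_of_pos_right h1 hT
      refine ⟨ht, ?_⟩
      rw [e ⟨ht.1.le, ht.2.le⟩, mode, mul_eq_zero, or_iff_right hc, H.fst_eq_zero]
      refine ⟨j, ?_⟩
      push_cast
      field_simp
  have hinj : InjOn (fun j : ℕ => (j : ℝ) * T / k) (Finset.Ioo 0 k : Set ℕ) := by
    intro i _ j _ hij
    simp only [div_left_inj' hk0.ne', mul_left_inj' hT.ne', Nat.cast_inj] at hij
    exact hij
  rw [HasPredZeros, hset, hinj.encard_image, encard_coe_eq_coe_finsetCard, Nat.card_Ioo]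
  norm_cast
  omega

theorem mem_spectralNumbers_iff (hp : 1 < p) (hq : 1 < q) (hr : 1 < r)
    (hpr : (p - 1) * (r - 1) = 1) (H : IsFundamental p q r l U U₁ V V₁) (hT : 0 < T) {ν : ℝ} :
    ν ∈ spectralNumbers p q T ↔ ∃ k : ℕ, 1 ≤ k ∧ ν = modeNumber p q T k l := by
  constructor
  · rintro ⟨g, hg⟩
    obtain ⟨k, hk, _, e⟩ := H.eq_mode hp hq hr hpr hT hg
    exact ⟨k, hk, e⟩
  · rintro ⟨k, hk, rfl⟩
    exact ⟨_, H.isSpectralCouple_mode hp hq hr hpr hT hk⟩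

/-- Strict monotonicity in the index makes the spectral numbers below the `k`-th exactly those with
`0 < j < k`. -/
theorem isNthSpectralNumber_iff (hp : 1 < p) (hq : 1 < q) (hr : 1 < r)
    (hpr : (p - 1) * (r - 1) = 1) (H : IsFundamental p q r l U U₁ V V₁) (hT : 0 < T) {k n : ℕ}
    (hk : 1 ≤ k) : IsNthSpectralNumber p q T n (modeNumber p q T k l) ↔ k = n := by
  have hset : {ν ∈ spectralNumbers p q T | ν < modeNumber p q T k l} =
      (fun j : ℕ => modeNumber p q T j l) '' (Finset.Ioo 0 k : Set ℕ) := by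
    ext ν
    simp only [mem_image, Finset.coe_Ioo, mem_Ioo,
      H.mem_spectralNumbers_iff hp hq hr hpr hT]
    constructor
    · rintro ⟨⟨j, hj, rfl⟩, hlt⟩
      exact ⟨j, ⟨hj, (modeNumber_strictMono hq hT H.pos).1 hlt⟩, rfl⟩
    · rintro ⟨j, ⟨hj, hlt⟩, rfl⟩
      exact ⟨⟨j, hj, rfl⟩, (modeNumber_strictMono hq hT H.pos).2 hlt⟩
  have hinj : InjOn (fun j : ℕ => modeNumber p q T j l) (Finset.Ioo 0 k : Set ℕ) := by
    have hm : StrictMono fun j : ℕ => modeNumber p q T j l := fun i j hij =>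
      (modeNumber_strictMono hq hT H.pos).2 hij
    exact hm.injective.injOn
  rw [IsNthSpectralNumber, hset, hinj.encard_image, encard_coe_eq_coe_finsetCard, Nat.card_Ioo,
    and_iff_right ((H.mem_spectralNumbers_iff hp hq hr hpr hT).2 ⟨k, hk, rfl⟩)]
  norm_cast
  omega

/-- The `n`-th mode is characterized both by its zeros and by its spectral number. -/
theorem isTheSpectralCouple (hp : 1 < p) (hq : 1 < q) (hr : 1 < r)
    (hpr : (p - 1) * (r - 1) = 1) (H : IsFundamental p q r l U U₁ V V₁) (hT : 0 < T) {n : ℕ}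
    (hn : 1 ≤ n) (e : EqOn f (mode p T n U) (Icc 0 T)) :
    IsSpectralCoupleWithZeros p q T n f (modeNumber p q T n l) ∧
      IsNthSpectralCouple p q T n f (modeNumber p q T n l) := by
  have hf := (H.isSpectralCouple_mode hp hq hr hpr hT hn).congr hT e
  refine ⟨⟨⟨hf, (H.hasPredZeros_iff hT hn e).2 rfl⟩, fun g ν hg hz => ?_⟩,
    ⟨⟨hf, (H.isNthSpectralNumber_iff hp hq hr hpr hT hn).2 rfl⟩, fun g ν hg hz => ?_⟩⟩
  · obtain ⟨k, hk, eg, rfl⟩ := H.eq_mode hp hq hr hpr hT hg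
    obtain rfl := (H.hasPredZeros_iff hT hk eg).1 hz
    exact ⟨eg.trans e.symm, rfl⟩
  · obtain ⟨k, hk, eg, rfl⟩ := H.eq_mode hp hq hr hpr hT hg
    obtain rfl := (H.isNthSpectralNumber_iff hp hq hr hpr hT hk).1 hz
    exact ⟨eg.trans e.symm, rfl⟩

theorem eq_mode_of_isNthSpectralNumber (hp : 1 < p) (hq : 1 < q) (hr : 1 < r)
    (hpr : (p - 1) * (r - 1) = 1) (H : IsFundamental p q r l U U₁ V V₁) (hT : 0 < T) {n : ℕ}
    {μ : ℝ} (hf : IsSpectralCouple p q T f μ) (hμ : IsNthSpectralNumber p q T n μ) :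
    EqOn f (mode p T n U) (Icc 0 T) ∧ μ = modeNumber p q T n l := by
  obtain ⟨k, hk, e, rfl⟩ := H.eq_mode hp hq hr hpr hT hf
  obtain rfl := (H.isNthSpectralNumber_iff hp hq hr hpr hT hk).1 hμ
  exact ⟨e, rfl⟩

/-- The first spectral couple on `[0,1]` determines the fundamental solution. -/
theorem eq_of_first (hp : 1 < p) (hq : 1 < q) (hr : 1 < r)
    (hpr : (p - 1) * (r - 1) = 1) (H : IsFundamental p q r l U U₁ V V₁) {F : ℝ → ℝ}
    {μ : ℝ} (hf : IsSpectralCouple p q 1 f μ) (hμ : IsNthSpectralNumber p q 1 1 μ)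
    (hF : IsOddPeriodicExtension f F) : F = U ∧ μ = l := by
  obtain ⟨e, rfl⟩ := H.eq_mode_of_isNthSpectralNumber hp hq hr hpr one_pos hf hμ
  refine ⟨hF.unique ⟨H.periodic_fst, H.odd_fst, fun t ht => ?_⟩, by simp [modeNumber]⟩
  rw [e ht]
  simp [mode]

end IsFundamental

end

/-! ### Assembly of the three statements. -/

theorem mainTheorem7 (p q : ℝ) (hp : 1 < p) (hq : 1 < q) (n : ℕ) (hn : 1 ≤ n)
    (t₀ : ℝ) (ht₀ : 0 < t₀) :
    -- (i) the unique spectral couple on `[0, t₀]` with `n - 1` interior zeros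
    (∃ f μ, IsSpectralCoupleWithZeros p q t₀ n f μ) ∧
    -- existence of the first spectral couple on `[0, 1]` and of its odd 2-periodic extension
    (∃ f₁ μ₁, IsNthSpectralCouple p q 1 1 f₁ μ₁) ∧
    (∀ f₁ μ₁, IsSpectralCouple p q 1 f₁ μ₁ → IsNthSpectralNumber p q 1 1 μ₁ →
      ∃! F, IsOddPeriodicExtension f₁ F) ∧
    -- (ii) the `n`-th spectral couple on `[0, 1]`
    (∀ f₁ μ₁ F, IsSpectralCouple p q 1 f₁ μ₁ → IsNthSpectralNumber p q 1 1 μ₁ →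
      IsOddPeriodicExtension f₁ F →
      IsNthSpectralCouple p q 1 n
        (fun t => F (n * t) / (n : ℝ) ^ 2) ((n : ℝ) ^ (2 * q) * μ₁) ∧
      IsSpectralCoupleWithZeros p q 1 n
        (fun t => F (n * t) / (n : ℝ) ^ 2) ((n : ℝ) ^ (2 * q) * μ₁)) ∧
    -- (iii) rescaling the `n`-th spectral couple from `[0, 1]` to `[0, t₀]`
    (∀ fₙ μₙ, IsSpectralCouple p q 1 fₙ μₙ → IsNthSpectralNumber p q 1 n μₙ →
      IsSpectralCoupleWithZeros p q t₀ n
        (fun t => t₀ ^ (2 - 1 / p) * fₙ (t / t₀)) (t₀ ^ (q / p - 1 - 2 * q) * μₙ) ∧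
      IsNthSpectralCouple p q t₀ n
        (fun t => t₀ ^ (2 - 1 / p) * fₙ (t / t₀)) (t₀ ^ (q / p - 1 - 2 * q) * μₙ)) ∧
    -- the explicit form of the `n`-th spectral couple on `[0, t₀]`
    (∀ f₁ μ₁ F, IsSpectralCouple p q 1 f₁ μ₁ → IsNthSpectralNumber p q 1 1 μ₁ →
      IsOddPeriodicExtension f₁ F →
      IsSpectralCoupleWithZeros p q t₀ n
        (fun t => t₀ ^ (2 - 1 / p) / (n : ℝ) ^ 2 * F (n * t / t₀))
        ((n : ℝ) ^ (2 * q) * t₀ ^ (q / p - 1 - 2 * q) * μ₁) ∧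
      IsNthSpectralCouple p q t₀ n
        (fun t => t₀ ^ (2 - 1 / p) / (n : ℝ) ^ 2 * F (n * t / t₀))
        ((n : ℝ) ^ (2 * q) * t₀ ^ (q / p - 1 - 2 * q) * μ₁)) := by
  have hpr := (Real.HolderConjugate.conjExponent hp).symm
  set r := p.conjExponent
  have hr : 1 < r := hpr.lt
  have hpr' : (p - 1) * (r - 1) = 1 := by
    have := hpr.sub_one_mul_conj
    linarith
  obtain ⟨l, U, U₁, V, V₁, H⟩ := exists_isFundamental hp hq hpr
  refine ⟨⟨_, _, (H.isTheSpectralCouple hp hq hr hpr' ht₀ hn (eqOn_refl _ _)).1⟩,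
    ⟨_, _, (H.isTheSpectralCouple hp hq hr hpr' one_pos le_rfl (eqOn_refl _ _)).2⟩,
    ?_, ?_, ?_, ?_⟩
  · intro f₁ μ₁ hf _
    have hext := isOddPeriodicExtension_oddExt hf.isEigenpair.left hf.isEigenpair.right
    exact ⟨_, hext, fun F hF => hF.unique hext⟩
  · intro f₁ μ₁ F hf hμ hF
    -- Any first couple yields the fundamental solution itself, so `F` may be replaced by `U` and
    -- the claim is about modes with `T = 1`.
    obtain ⟨rfl, rfl⟩ := H.eq_of_first hp hq hr hpr' hf hμ hF
    have := H.isTheSpectralCouple hp hq hr hpr' one_pos hn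
      (f := fun t => F (n * t) / (n : ℝ) ^ 2) (fun t _ => by simp [mode, div_eq_inv_mul])
    simp only [modeNumber, Real.one_rpow, mul_one] at this
    exact this.symm
  · intro fₙ μₙ hf hμ
    obtain ⟨e, rfl⟩ := H.eq_mode_of_isNthSpectralNumber hp hq hr hpr' one_pos hf hμ
    have := H.isTheSpectralCouple hp hq hr hpr' ht₀ hn
      (f := fun t => t₀ ^ (2 - 1 / p) * fₙ (t / t₀)) (fun t ht => by
        have ht' : t / t₀ ∈ Icc (0 : ℝ) 1 := ⟨div_nonneg ht.1 ht₀.le, (div_le_one ht₀).2 ht.2⟩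
        simp only [e ht', mode, Real.one_rpow, div_one, mul_div_assoc]
        ring)
    have e2 : t₀ ^ (q / p - 1 - 2 * q) * modeNumber p q 1 n l = modeNumber p q t₀ n l := by
      simp only [modeNumber, Real.one_rpow]; ring
    rw [e2]
    exact this
  · intro f₁ μ₁ F hf hμ hF
    obtain ⟨rfl, rfl⟩ := H.eq_of_first hp hq hr hpr' hf hμ hF
    exact H.isTheSpectralCouple hp hq hr hpr' ht₀ hn (eqOn_refl _ _)
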